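/- Let $N\ge 2$, let $\Omega\subset\mathbb{R}^N$ be a bounded domain (a nonempty, connected, bounded open set; no regularity of the boundary is needed), and let $f\in C^1(\mathbb{R},\mathbb{R})$, $F(s)=\int_0^s f(r)\,dr$. Assume: $(f_1)$ if $N=2$, then $\lim_{|t|\to\infty} f'(t)/e^{\beta t^2}=0$ for every $\beta>0$; if $N\ge 3$, then there are $q\in[2,2^*]$, where $2^*=\frac{2N}{N-2}$, $p\in(1,q/2)$ and $C_2>0$ such that $|f(t)|\le C_2(1+|t|^p)$ for all $t\in\mathbb{R}$; $(f_2)$ $\lim_{t\to 0} f(t)/t=0$; $(f_3)$ there is $\gamma>0$ such that $f(s)s\ge(2+\gamma)F(s)>0$ for all $s\in\mathbb{R}\setminus\{0\}$. Let $H^1_0(\Omega)$ be the closure of $C_c^\infty(\Omega)$ in $H^1(\Omega)$, with the norm $\|u\|=\left(\int_\Omega|\nabla u|^2\,dx\right)^{1/2}$. Then $F(u)\in L^1(\Omega)$ for every $u\in H^1_0(\Omega)$, the functional $$E(u)=\frac12\int_\Omega|\nabla u|^2\,dx-\int_\Omega F(u)\,dx$$ is of class $C^1$ on $H^1_0(\Omega)$,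 and $E$ satisfies the Palais–Smale condition: for every $d\in\mathbb{R}$, every sequence $(u_n)$ in $H^1_0(\Omega)$ with $E(u_n)\to d$ and $E'(u_n)\to 0$ in the dual space $H^1_0(\Omega)^*$ has a subsequence that converges in the norm of $H^1_0(\Omega)$. -/

import Mathlib

open MeasureTheory Filter Topology
open scoped ENNReal NNReal ContDiff Gradient

noncomputable section

namespace SemilinearPS

/-- A bounded domain of `ℝ^N`: a nonempty, connected, bounded open set. No regularity of the
boundary is required. -/
structure BoundedDomain (N : ℕ) where
  carrier : Set (EuclideanSpace ℝ (Fin N))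
  isOpen : IsOpen carrier
  isConnected : IsConnected carrier
  isBounded : Bornology.IsBounded carrier

variable {N : ℕ}

/-- Lebesgue measure on the domain. -/
abbrev BoundedDomain.μ (Ω : BoundedDomain N) : Measure (EuclideanSpace ℝ (Fin N)) :=
  volume.restrict Ω.carrier

instance (Ω : BoundedDomain N) : IsFiniteMeasure Ω.μ :=
  ⟨by simpa using Ω.isBounded.measure_lt_top⟩

/-- `φ ∈ C_c^∞(Ω)`. -/
structure IsTestFunction (Ω : BoundedDomain N) (φ : EuclideanSpace ℝ (Fin N) → ℝ) : Prop where
  smooth : ContDiff ℝ ∞ φ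
  compact : HasCompactSupport φ
  support : tsupport φ ⊆ Ω.carrier

theorem IsTestFunction.add {Ω : BoundedDomain N} {φ ψ : EuclideanSpace ℝ (Fin N) → ℝ}
    (hφ : IsTestFunction Ω φ) (hψ : IsTestFunction Ω ψ) : IsTestFunction Ω (φ + ψ) :=
  ⟨hφ.smooth.add hψ.smooth, hφ.compact.add hψ.compact,
    (tsupport_add φ ψ).trans (Set.union_subset hφ.support hψ.support)⟩

theorem IsTestFunction.const_smul {Ω : BoundedDomain N} {φ : EuclideanSpace ℝ (Fin N) → ℝ}
    (c : ℝ) (hφ : IsTestFunction Ω φ) : IsTestFunction Ω (c • φ) := by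
  have h : tsupport (c • φ) ⊆ tsupport φ :=
    closure_mono (Function.support_const_smul_subset c φ)
  exact ⟨hφ.smooth.const_smul c, hφ.compact.mono' ((subset_tsupport _).trans h), h.trans hφ.support⟩

/-- The pairs `(φ, ∇φ)`, `φ ∈ C_c^∞(Ω)`, as elements of `L²(Ω) × L²(Ω; ℝ^N)`. -/
def testGraph (Ω : BoundedDomain N) :
    Submodule ℝ (Lp ℝ 2 Ω.μ × Lp (EuclideanSpace ℝ (Fin N)) 2 Ω.μ) where
  carrier := {w | ∃ φ, IsTestFunction Ω φ ∧ w.1 =ᵐ[Ω.μ] φ ∧ w.2 =ᵐ[Ω.μ] ∇ φ}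
  zero_mem' := by
    refine ⟨0, ⟨contDiff_const, HasCompactSupport.zero, by simp [tsupport]⟩, Lp.coeFn_zero _ _ _, ?_⟩
    filter_upwards [Lp.coeFn_zero (EuclideanSpace ℝ (Fin N)) 2 Ω.μ] with x hx
    simp only [Prod.snd_zero, hx, gradient, fderiv_zero, Pi.zero_apply, map_zero]
  add_mem' := by
    rintro v w ⟨φ, hφ, h1, h2⟩ ⟨ψ, hψ, h3, h4⟩
    refine ⟨φ + ψ, hφ.add hψ, (Lp.coeFn_add _ _).trans (h1.add h3), ?_⟩
    refine (Lp.coeFn_add _ _).trans ?_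
    filter_upwards [h2, h4] with x hx hx'
    have hd : fderiv ℝ (φ + ψ) x = fderiv ℝ φ x + fderiv ℝ ψ x :=
      fderiv_add (hφ.smooth.differentiable (by simp) x) (hψ.smooth.differentiable (by simp) x)
    simp only [Pi.add_apply, hx, hx', gradient, hd, map_add]
  smul_mem' := by
    rintro c v ⟨φ, hφ, h1, h2⟩
    refine ⟨c • φ, hφ.const_smul c, (Lp.coeFn_smul _ _).trans (h1.const_smul c), ?_⟩
    refine (Lp.coeFn_smul _ _).trans ?_
    filter_upwards [h2] with x hx
    have hd : fderiv ℝ (c • φ) x = c • fderiv ℝ φ x :=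
      fderiv_const_smul (hφ.smooth.differentiable (by simp) x) c
    simp only [Pi.smul_apply, hx, gradient, hd, map_smul]

/-- The Sobolev space `H^1_0(Ω)`: the closure of `C_c^∞(Ω)` in `H^1(Ω)`. A function of `H^1(Ω)`
is recorded together with its weak gradient, so that `H^1(Ω)` is a subspace of
`L²(Ω) × L²(Ω; ℝ^N)` carrying the induced topology. -/
def H01 (Ω : BoundedDomain N) : Type := ↥(testGraph Ω).topologicalClosure

namespace H01

variable {Ω : BoundedDomain N}

instance : AddCommGroup (H01 Ω) := inferInstanceAs (AddCommGroup ↥(testGraph Ω).topologicalClosure)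

instance : Module ℝ (H01 Ω) := inferInstanceAs (Module ℝ ↥(testGraph Ω).topologicalClosure)

/-- The function underlying an element of `H^1_0(Ω)`. -/
def val : H01 Ω →ₗ[ℝ] Lp ℝ 2 Ω.μ :=
  (LinearMap.fst ℝ _ _).comp (testGraph Ω).topologicalClosure.subtype

/-- The weak gradient of an element of `H^1_0(Ω)`. -/
def grad : H01 Ω →ₗ[ℝ] Lp (EuclideanSpace ℝ (Fin N)) 2 Ω.μ :=
  (LinearMap.snd ℝ _ _).comp (testGraph Ω).topologicalClosure.subtype

end H01

/-- Poincaré's inequality for test functions. -/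
theorem exists_poincare [N.AtLeastTwo] (Ω : BoundedDomain N) :
    ∃ C : ℝ, ∀ w ∈ testGraph Ω, ‖w.1‖ ≤ C * ‖w.2‖ := by
  have hN : (2 : ℝ) ≤ N := by exact_mod_cast Nat.AtLeastTwo.prop
  have hN' : (2 : ℝ≥0) ≤ N := by exact_mod_cast (Nat.AtLeastTwo.prop : 2 ≤ N)
  set p : ℝ≥0 := 2 * N / (N + 2) with hp
  have hp1 : 1 ≤ p := by
    rw [hp, one_le_div (by positivity)]
    calc (N : ℝ≥0) + 2 ≤ N + N := by gcongr
      _ = 2 * N := by ring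
  have hpN : p < N := by
    rw [hp, div_lt_iff₀ (by positivity), mul_comm]
    have h0 : (0 : ℝ≥0) < N := lt_of_lt_of_le (by norm_num) hN'
    gcongr
    exact lt_add_of_pos_left 2 h0
  have hp2 : p ≤ 2 := by
    rw [hp, div_le_iff₀ (by positivity)]
    gcongr
    exact le_self_add
  have hpq : (p : ℝ)⁻¹ - (N : ℝ)⁻¹ ≤ ((2 : ℝ≥0) : ℝ)⁻¹ := by
    rw [hp]
    push_cast
    have : (N : ℝ) ≠ 0 := by linarith
    apply le_of_eq
    field_simp
    ring
  set K := eLpNormLESNormFDerivOfLeConst ℝ (volume : Measure (EuclideanSpace ℝ (Fin N)))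
    Ω.carrier p 2
  set M : ℝ≥0∞ := Ω.μ Set.univ ^ (1 / (p : ℝ≥0∞).toReal - 1 / (2 : ℝ≥0∞).toReal)
  have hM : M ≠ ⊤ := by
    refine ENNReal.rpow_ne_top_of_nonneg ?_ (measure_ne_top _ _)
    simp only [ENNReal.coe_toReal, ENNReal.toReal_ofNat, one_div, sub_nonneg]
    exact inv_anti₀ (by exact_mod_cast zero_lt_one.trans_le hp1) (by exact_mod_cast hp2)
  refine ⟨(K * M).toReal, ?_⟩
  rintro ⟨u, g⟩ ⟨φ, hφ, hu, hg⟩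
  simp only at hu hg ⊢
  have hsup : φ.support ⊆ Ω.carrier := (subset_tsupport φ).trans hφ.support
  have hsup' : (∇ φ).support ⊆ Ω.carrier := by
    refine subset_trans (fun x hx => ?_) ((support_fderiv_subset ℝ (f := φ)).trans hφ.support)
    intro h0
    exact hx (by simp [gradient, h0])
  have hcont : Continuous (∇ φ) :=
    (InnerProductSpace.toDual ℝ (EuclideanSpace ℝ (Fin N))).symm.continuous.comp
      (hφ.smooth.continuous_fderiv (by simp))
  have hnorm : eLpNorm (fderiv ℝ φ) p volume = eLpNorm (∇ φ) p volume :=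
    eLpNorm_congr_norm_ae (Eventually.of_forall fun x => by simp [gradient])
  have h1 : eLpNorm u 2 Ω.μ = eLpNorm φ (2 : ℝ≥0) volume :=
    (eLpNorm_congr_ae hu).trans (eLpNorm_restrict_eq_of_support_subset hsup)
  have h2 : eLpNorm φ (2 : ℝ≥0) volume ≤ K * eLpNorm (∇ φ) p volume := by
    rw [← hnorm]
    exact eLpNorm_le_eLpNorm_fderiv_of_le volume (hφ.smooth.of_le (by simp)) hsup hp1
      (by simpa using hpN) (by simpa using hpq) Ω.isBounded
  have h3 : eLpNorm (∇ φ) p volume = eLpNorm (∇ φ) p Ω.μ :=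
    (eLpNorm_restrict_eq_of_support_subset hsup').symm
  have h4 : eLpNorm (∇ φ) p Ω.μ ≤ eLpNorm g 2 Ω.μ * M := by
    rw [eLpNorm_congr_ae hg]
    exact eLpNorm_le_eLpNorm_mul_rpow_measure_univ (by exact_mod_cast hp2)
      hcont.aestronglyMeasurable
  have key : eLpNorm u 2 Ω.μ ≤ K * M * eLpNorm g 2 Ω.μ := by
    rw [h1]
    refine h2.trans ?_
    rw [h3, mul_assoc, mul_comm M]
    exact mul_le_mul_right h4 _
  rw [Lp.norm_def, Lp.norm_def, ← ENNReal.toReal_mul]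
  exact ENNReal.toReal_mono
    (ENNReal.mul_ne_top (ENNReal.mul_ne_top ENNReal.coe_ne_top hM) (Lp.eLpNorm_ne_top g)) key

theorem H01.grad_injective [N.AtLeastTwo] {Ω : BoundedDomain N} :
    Function.Injective (H01.grad (Ω := Ω)) := by
  obtain ⟨C, hC⟩ := exists_poincare Ω
  have hcl : ∀ w ∈ (testGraph Ω).topologicalClosure, ‖w.1‖ ≤ C * ‖w.2‖ := by
    intro w hw
    have hclosed : IsClosed
        {w : Lp ℝ 2 Ω.μ × Lp (EuclideanSpace ℝ (Fin N)) 2 Ω.μ | ‖w.1‖ ≤ C * ‖w.2‖} :=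
      isClosed_le (by fun_prop) (by fun_prop)
    have hsub : ((testGraph Ω : Submodule ℝ _) : Set _) ⊆
        {w : Lp ℝ 2 Ω.μ × Lp (EuclideanSpace ℝ (Fin N)) 2 Ω.μ | ‖w.1‖ ≤ C * ‖w.2‖} :=
      fun w hw => hC w hw
    exact closure_minimal hsub hclosed hw
  rw [injective_iff_map_eq_zero]
  rintro ⟨w, hw⟩ h
  have h2 : w.2 = 0 := h
  have h1 : w.1 = 0 := by simpa [h2] using hcl w hw
  exact Subtype.ext (Prod.ext h1 h2)

/-- The norm of `H^1_0(Ω)` is `‖u‖ = (∫_Ω |∇u|²)^{1/2}`. -/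
instance [N.AtLeastTwo] (Ω : BoundedDomain N) : NormedAddCommGroup (H01 Ω) :=
  NormedAddCommGroup.induced (H01 Ω) (Lp (EuclideanSpace ℝ (Fin N)) 2 Ω.μ) H01.grad
    H01.grad_injective

/-- The inner product of `H^1_0(Ω)` is `⟨u, v⟩ = ∫_Ω ∇u · ∇v`. -/
instance [N.AtLeastTwo] (Ω : BoundedDomain N) : InnerProductSpace ℝ (H01 Ω) where
  norm_smul_le c u := by
    change ‖H01.grad (c • u)‖ ≤ ‖c‖ * ‖H01.grad u‖
    rw [map_smul, norm_smul]
  inner u v := inner ℝ (H01.grad u) (H01.grad v)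
  norm_sq_eq_re_inner u := norm_sq_eq_re_inner (𝕜 := ℝ) (H01.grad u)
  conj_inner_symm u v := inner_conj_symm (𝕜 := ℝ) (H01.grad u) (H01.grad v)
  add_left u v w := by simp only [map_add, inner_add_left]
  smul_left u v c := by simp only [map_smul, inner_smul_left]

/-- The primitive `F(s) = ∫_0^s f(r) dr`. -/
def primitive (f : ℝ → ℝ) (s : ℝ) : ℝ := ∫ r in (0 : ℝ)..s, f r

/-- The energy `E(u) = ½ ∫_Ω |∇u|² - ∫_Ω F(u)`. -/
def energy (Ω : BoundedDomain N) (f : ℝ → ℝ) (u : H01 Ω) : ℝ :=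
  (∫ x, (1 / 2 : ℝ) * ‖H01.grad u x‖ ^ 2 ∂Ω.μ) - ∫ x, primitive f (H01.val u x) ∂Ω.μ

/-- Subcritical growth, where `cocompact ℝ` expresses `|t| → ∞` and
`2N / (N - 2)` is the critical Sobolev exponent. -/
def SubcriticalGrowth (N : ℕ) (f : ℝ → ℝ) : Prop :=
  (N = 2 → ∀ β : ℝ, 0 < β →
    Tendsto (fun t : ℝ => deriv f t / Real.exp (β * t ^ 2)) (cocompact ℝ) (𝓝 0)) ∧
  (3 ≤ N → ∃ q : ℝ, 2 ≤ q ∧ q ≤ 2 * (N : ℝ) / ((N : ℝ) - 2) ∧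
    ∃ C₂ p : ℝ, 0 < C₂ ∧ 1 < p ∧ p < q / 2 ∧ ∀ t : ℝ, |f t| ≤ C₂ * (1 + |t| ^ p))

/-- `f(t) / t → 0` as `t → 0`, `t ≠ 0`. -/
def SuperlinearAtZero (f : ℝ → ℝ) : Prop := Tendsto (fun t : ℝ => f t / t) (𝓝[≠] 0) (𝓝 0)

/-- The Ambrosetti–Rabinowitz condition. -/
def AmbrosettiRabinowitz (f : ℝ → ℝ) : Prop :=
  ∃ γ : ℝ, 0 < γ ∧ ∀ s : ℝ, s ≠ 0 →
    (2 + γ) * primitive f s ≤ f s * s ∧ 0 < (2 + γ) * primitive f s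

/-- The Palais–Smale condition: every sequence with `J(u_n) → d` for some real `d` and
`J'(u_n) → 0` in the dual space has a convergent subsequence. -/
def PalaisSmale {X : Type*} [NormedAddCommGroup X] [NormedSpace ℝ X] (J : X → ℝ) : Prop :=
  ∀ (d : ℝ) (u : ℕ → X), Tendsto (fun n => J (u n)) atTop (𝓝 d) →
    Tendsto (fun n => fderiv ℝ J (u n)) atTop (𝓝 0) →
    ∃ (v : X) (k : ℕ → ℕ), StrictMono k ∧ Tendsto (fun n => u (k n)) atTop (𝓝 v)

end SemilinearPS

end

/-!
The energy is `½‖u‖² - ∫ F(u)` on the Hilbert space `H^1_0(Ω)`, and everything rests on two facts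
about the embedding `ι : H^1_0(Ω) → L²(Ω)`.

* *Integrability* (`SubcriticalGrowth.boundedSubstitution`). The map `u ↦ f(u)` sends bounded sets of
  `H^1_0(Ω)` to bounded sets of some `L^r`, `r > 2`. For `N ≥ 3` this is Sobolev's inequality, as the
  growth exponent of `f` is below half the critical one. For `N = 2` it is Trudinger's inequality
  `exists_trudinger`, derived from the `L¹` Sobolev inequality: applied to smooth truncations of `φ`,
  that inequality bounds the measure of `{φ > t + h}` by the measure of `{φ > t}` times the gradient
  energy of the layer `t < φ ≤ t + h` over `h²`. The energies of `n` layers have a bounded sum, so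
  their product is at most that of equal shares, and the measure of `{φ > l √n}` decays like
  `4 ^ (-n)` (`exists_superlevel_le`). In both cases Fatou's lemma passes from test functions to all
  of `H^1_0(Ω)`.
* *Compactness* (`sequentiallyCompactMap_valL`). Cutting space into cubes of side `δ` and bounding the
  oscillation on cubes by translations gives Friedrichs' inequality `exists_friedrichs`: the `L²` norm
  is at most `ε` times the gradient norm plus finitely many linear functionals. Along a weakly
  convergent subsequence these functionals converge.

Given the first fact, Vitali's theorem makes `u ↦ f(u)` continuous into `L²` (`continuous_nemytskii`),
whence `u ↦ ∫ F(u)` is `C^1` with derivative `v ↦ ∫ f(u) v` (`hasFDerivAt_integral_primitive`).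

For the Palais–Smale condition, the Ambrosetti–Rabinowitz inequality bounds `‖u‖²` by
`E(u) - E'(u)u / (2 + γ)`, so Palais–Smale sequences are bounded. Identifying `E'(u)` with a vector,
`u = E'(u) + ι† f(u)`; here `E'(u_n) → 0`, the sequence `f(u_n)` is bounded in `L²`, and the adjoint
`ι†` of a compact map is compact, so a subsequence converges (`palaisSmale_abstractEnergy`).
-/

/-! ### The Hilbert space `H^1_0(Ω)` -/

namespace SemilinearPS

namespace H01

variable {N : ℕ} {Ω : BoundedDomain N}

/-- An `L²`-closed condition on a function and its gradient that holds for all test functions holds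
throughout `H^1_0(Ω)`. -/
theorem induction_closed {P : Lp ℝ 2 Ω.μ × Lp (EuclideanSpace ℝ (Fin N)) 2 Ω.μ → Prop}
    (hP : IsClosed {w | P w}) (ht : ∀ w ∈ testGraph Ω, P w) (u : H01 Ω) : P (val u, grad u) :=
  closure_minimal (t := {w | P w}) (fun w hw => ht w hw) hP u.2

variable [N.AtLeastTwo]

theorem norm_eq (u : H01 Ω) : ‖u‖ = ‖grad u‖ := rfl

/-- Poincaré's inequality on the closure of the test functions. -/
theorem exists_poincare (Ω : BoundedDomain N) : ∃ C : ℝ, ∀ u : H01 Ω, ‖val u‖ ≤ C * ‖u‖ := by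
  obtain ⟨C, hC⟩ := SemilinearPS.exists_poincare Ω
  exact ⟨C, induction_closed (P := fun w => ‖w.1‖ ≤ C * ‖w.2‖)
    (isClosed_le (by fun_prop) (by fun_prop)) hC⟩

/-- The embedding `H^1_0(Ω) → L²(Ω)` as a continuous linear map. -/
noncomputable def valL (Ω : BoundedDomain N) : H01 Ω →L[ℝ] Lp ℝ 2 Ω.μ :=
  LinearMap.mkContinuousOfExistsBound val (exists_poincare Ω)

@[simp] theorem valL_apply (u : H01 Ω) : valL Ω u = val u := rfl

/-- The gradient as a linear isometry into `L²(Ω; ℝ^N)`. -/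
noncomputable def gradL (Ω : BoundedDomain N) :
    H01 Ω →ₗᵢ[ℝ] Lp (EuclideanSpace ℝ (Fin N)) 2 Ω.μ where
  toLinearMap := grad
  norm_map' _ := rfl

theorem tendsto_of_tendsto_grad {ι : Type*} {l : Filter ι} {u : ι → H01 Ω} {v : H01 Ω}
    (h : Tendsto (fun i => grad (u i)) l (𝓝 (grad v))) : Tendsto u l (𝓝 v) := by
  rw [tendsto_iff_norm_sub_tendsto_zero] at h ⊢
  simpa only [norm_eq, map_sub] using h

/-- `H^1_0(Ω)` is closed in `L² × L²`, and Poincaré's inequality turns a Cauchy sequence of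
gradients into a Cauchy sequence of pairs. -/
instance : CompleteSpace (H01 Ω) := by
  refine Metric.complete_of_cauchySeq_tendsto fun u hu => ?_
  obtain ⟨a, ha⟩ := cauchySeq_tendsto_of_complete ((valL Ω).uniformContinuous.comp_cauchySeq hu)
  obtain ⟨b, hb⟩ := cauchySeq_tendsto_of_complete
    ((gradL Ω).isometry.uniformContinuous.comp_cauchySeq hu)
  have hmem : (a, b) ∈ (testGraph Ω).topologicalClosure :=
    (Submodule.isClosed_topologicalClosure _).mem_of_tendsto (ha.prodMk_nhds hb)
      (Eventually.of_forall fun n => (u n).2)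
  exact ⟨⟨(a, b), hmem⟩, tendsto_of_tendsto_grad hb⟩

/-- Test functions are dense for the gradient norm. -/
theorem exists_seq_testFunction (u : H01 Ω) :
    ∃ (w : ℕ → H01 Ω) (φ : ℕ → EuclideanSpace ℝ (Fin N) → ℝ), Tendsto w atTop (𝓝 u) ∧
      ∀ n, IsTestFunction Ω (φ n) ∧ val (w n) =ᵐ[Ω.μ] φ n ∧ grad (w n) =ᵐ[Ω.μ] ∇ (φ n) := by
  obtain ⟨w, hw, hlim⟩ := mem_closure_iff_seq_limit.1
    (show (val u, grad u) ∈ closure (testGraph Ω : Set _) from u.2)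
  choose φ hφ using hw
  refine ⟨fun n => ⟨w n, subset_closure ⟨φ n, hφ n⟩⟩, φ,
    tendsto_of_tendsto_grad ?_, fun n => hφ n⟩
  exact (continuous_snd.tendsto _).comp hlim

end H01

/-! ### Superposition operators and integral functionals -/

section Nemytskii

variable {α : Type*} [MeasurableSpace α] {μ : Measure α}

/-- By Hölder's inequality, a family bounded in `L^r` is uniformly `p`-integrable for `p < r`. -/
theorem unifIntegrable_of_eLpNorm_le {ι : Type*} {h : ι → α → ℝ} {p r B : ℝ≥0∞}
    (hp : p ≠ 0) (hpr : p < r) (hB : B ≠ ⊤) (hm : ∀ i, AEStronglyMeasurable (h i) μ)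
    (hle : ∀ i, eLpNorm (h i) r μ ≤ B) : UnifIntegrable h p μ := by
  intro ε hε
  set θ : ℝ := 1 / p.toReal - 1 / r.toReal with hθ
  have hp0 : 0 < p.toReal := ENNReal.toReal_pos hp hpr.ne_top
  have hθ0 : 0 < θ := by
    rcases eq_or_ne r ⊤ with rfl | hr
    · simpa [hθ] using hp0
    · exact sub_pos.2 (one_div_lt_one_div_of_lt hp0
        ((ENNReal.toReal_lt_toReal hpr.ne_top hr).2 hpr))
  have hlim : Tendsto (fun δ : ℝ => B * ENNReal.ofReal δ ^ θ) (𝓝[>] 0) (𝓝 0) := by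
    have h1 : Tendsto (fun δ : ℝ => ENNReal.ofReal δ ^ θ) (𝓝[>] 0) (𝓝 0) := by
      have := ((ENNReal.continuous_rpow_const (y := θ)).comp ENNReal.continuous_ofReal).tendsto 0
      simp only [Function.comp_def, ENNReal.ofReal_zero, ENNReal.zero_rpow_of_pos hθ0] at this
      exact this.mono_left nhdsWithin_le_nhds
    simpa using ENNReal.Tendsto.const_mul h1 (Or.inr hB)
  obtain ⟨δ, hδ, hδ0⟩ := ((hlim.eventually_le_const
    (ENNReal.ofReal_pos.2 hε)).and self_mem_nhdsWithin).exists
  refine ⟨δ, hδ0, fun i s hs hμs => ?_⟩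
  rw [eLpNorm_indicator_eq_eLpNorm_restrict hs]
  calc eLpNorm (h i) p (μ.restrict s)
      ≤ eLpNorm (h i) r (μ.restrict s) * (μ.restrict s) Set.univ ^ θ :=
        eLpNorm_le_eLpNorm_mul_rpow_measure_univ hpr.le (hm i).restrict
    _ ≤ B * ENNReal.ofReal δ ^ θ := by
        rw [Measure.restrict_apply_univ]
        gcongr
        exact (eLpNorm_mono_measure _ Measure.restrict_le_self).trans (hle i)
    _ ≤ _ := hδ

variable {X : Type*} [NormedAddCommGroup X] [NormedSpace ℝ X]

/-- The substitution `u ↦ f(u)` maps bounded sets of `X` to sets bounded in some `L^r`, `r > 2`.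
The exponent may depend on the bounded set. -/
def BoundedSubstitution (ι : X →L[ℝ] Lp ℝ 2 μ) (f : ℝ → ℝ) : Prop :=
  ∀ M : ℝ, ∃ r : ℝ≥0∞, 2 < r ∧ ∃ B : ℝ≥0∞, B ≠ ⊤ ∧
    ∀ u, ‖u‖ ≤ M → eLpNorm (fun x => f (ι u x)) r μ ≤ B

variable {ι : X →L[ℝ] Lp ℝ 2 μ} {f : ℝ → ℝ}

theorem aestronglyMeasurable_comp_Lp (hf : Continuous f) (w : Lp ℝ 2 μ) :
    AEStronglyMeasurable (fun x => f (w x)) μ :=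
  (hf.comp_stronglyMeasurable (Lp.stronglyMeasurable w)).aestronglyMeasurable

variable [IsFiniteMeasure μ]

theorem BoundedSubstitution.memLp (h : BoundedSubstitution ι f) (hf : Continuous f) (u : X) :
    MemLp (fun x => f (ι u x)) 2 μ := by
  obtain ⟨r, hr, B, hB, hle⟩ := h ‖u‖
  exact MemLp.mono_exponent ⟨aestronglyMeasurable_comp_Lp hf _,
    (hle u le_rfl).trans_lt hB.lt_top⟩ hr.le

/-- The superposition (Nemytskii) operator `u ↦ f(u)` with values in `L²`. -/
noncomputable def nemytskii (h : BoundedSubstitution ι f) (hf : Continuous f) (u : X) :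
    Lp ℝ 2 μ := (h.memLp hf u).toLp _

theorem coeFn_nemytskii (h : BoundedSubstitution ι f) (hf : Continuous f) (u : X) :
    nemytskii h hf u =ᵐ[μ] fun x => f (ι u x) := MemLp.coeFn_toLp _

/-- The superposition operator maps bounded sets to bounded sets. -/
theorem exists_norm_nemytskii_le (h : BoundedSubstitution ι f) (hf : Continuous f) (M : ℝ) :
    ∃ D, ∀ u, ‖u‖ ≤ M → ‖nemytskii h hf u‖ ≤ D := by
  obtain ⟨r, hr, B, hB, hle⟩ := h M
  set A := B * μ Set.univ ^ (1 / (2 : ℝ≥0∞).toReal - 1 / r.toReal)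
  have hA : A ≠ ⊤ := by
    refine ENNReal.mul_ne_top hB (ENNReal.rpow_ne_top_of_nonneg ?_ (measure_ne_top _ _))
    rcases eq_or_ne r ⊤ with rfl | hr'
    · simp
    · exact (sub_pos.2 (one_div_lt_one_div_of_lt (by simp)
        ((ENNReal.toReal_lt_toReal hr.ne_top hr').2 hr))).le
  refine ⟨A.toReal, fun u hu => ?_⟩
  rw [nemytskii, Lp.norm_toLp]
  refine ENNReal.toReal_mono hA ((eLpNorm_le_eLpNorm_mul_rpow_measure_univ hr.le
    (aestronglyMeasurable_comp_Lp hf _)).trans ?_)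
  exact mul_le_mul' (hle u hu) le_rfl

/-- Vitali's convergence theorem along almost everywhere convergent subsequences. -/
theorem continuous_nemytskii (h : BoundedSubstitution ι f) (hf : Continuous f) :
    Continuous (nemytskii h hf) := by
  rw [continuous_iff_seqContinuous]
  intro u v huv
  refine tendsto_of_subseq_tendsto fun ns hns => ?_
  have hι : Tendsto (fun n => ι (u (ns n))) atTop (𝓝 (ι v)) :=
    (ι.continuous.tendsto v).comp (huv.comp hns)
  obtain ⟨ms, -, hms⟩ := (tendstoInMeasure_of_tendsto_Lp hι).exists_seq_tendsto_ae
  refine ⟨ms, ?_⟩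
  obtain ⟨M, hM⟩ := huv.norm.isBoundedUnder_le.bddAbove_range
  obtain ⟨r, hr, B, hB, hle⟩ := h M
  have hui : UnifIntegrable (fun n x => f (ι (u (ns (ms n))) x)) 2 μ :=
    unifIntegrable_of_eLpNorm_le (by simp) hr hB
      (fun n => aestronglyMeasurable_comp_Lp hf _)
      fun n => hle _ (hM ⟨_, rfl⟩)
  have key := tendsto_Lp_finite_of_tendsto_ae (p := 2) (by simp) (by simp)
    (fun n => aestronglyMeasurable_comp_Lp hf _) (h.memLp hf v) hui
    (by filter_upwards [hms] with x hx using (hf.tendsto _).comp hx)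
  exact (Lp.tendsto_Lp_iff_tendsto_eLpNorm'' _ (fun n => h.memLp hf _) _ (h.memLp hf v)).2 key

theorem primitive_hasDerivAt (hf : Continuous f) (s : ℝ) : HasDerivAt (primitive f) (f s) s :=
  intervalIntegral.integral_hasDerivAt_right (hf.intervalIntegrable _ _)
    (hf.stronglyMeasurableAtFilter _ _) hf.continuousAt

theorem continuous_primitive (hf : Continuous f) : Continuous (primitive f) :=
  continuous_iff_continuousAt.2 fun s => (primitive_hasDerivAt hf s).continuousAt

/-- The first-order Taylor remainder of the primitive in integral form. -/
theorem enorm_primitive_add_sub_le (hf : Continuous f) (a b c : ℝ) :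
    ‖primitive f (a + b) - primitive f a - c * b‖ₑ ≤
      ∫⁻ s : ℝ in Set.Icc (0 : ℝ) 1, ‖f (a + s * b) - c‖ₑ * ‖b‖ₑ := by
  have hder : ∀ s ∈ Set.uIcc (0 : ℝ) 1, HasDerivAt
      (fun s => primitive f (a + s * b) - c * (s * b)) ((f (a + s * b) - c) * b) s := by
    intro s _
    have h1 : HasDerivAt (fun s : ℝ => s * b) b s := by
      simpa using (hasDerivAt_id s).mul_const b
    have h2 := (primitive_hasDerivAt hf (a + s * b)).comp s (h1.const_add a)
    exact (h2.sub (h1.const_mul c)).congr_deriv (by ring)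
  have hc : Continuous fun s : ℝ => (f (a + s * b) - c) * b := by fun_prop
  have := intervalIntegral.integral_eq_sub_of_hasDerivAt hder (hc.intervalIntegrable _ _)
  have h3 : primitive f (a + b) - primitive f a - c * b =
      ∫ s in Set.Icc (0 : ℝ) 1, (f (a + s * b) - c) * b := by
    rw [integral_Icc_eq_integral_Ioc, ← intervalIntegral.integral_of_le zero_le_one, this]
    simp
    ring
  rw [h3]
  refine (enorm_integral_le_lintegral_enorm _).trans_eq ?_
  simp_rw [enorm_mul]

/-- Integrated form of the Taylor remainder: Tonelli in the segment parameter and Hölder in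
space. -/
theorem lintegral_primitive_remainder_le (h : BoundedSubstitution ι f) (hf : Continuous f)
    (u v : X) (g : Lp ℝ 2 μ) {A : ℝ}
    (hA : ∀ s ∈ Set.Icc (0 : ℝ) 1, ‖nemytskii h hf (u + s • v) - g‖ ≤ A) :
    ∫⁻ x, ‖primitive f (ι (u + v) x) - primitive f (ι u x) - g x * ι v x‖ₑ ∂μ ≤
      ENNReal.ofReal (A * ‖ι v‖) := by
  have hadd : ∀ s : ℝ, ι (u + s • v) =ᵐ[μ] fun x => ι u x + s * ι v x := by
    intro s
    rw [map_add, map_smul]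
    filter_upwards [Lp.coeFn_add (ι u) (s • ι v), Lp.coeFn_smul s (ι v)] with x h1 h2
    rw [h1, Pi.add_apply, h2, Pi.smul_apply, smul_eq_mul]
  have hm : Measurable (Function.uncurry fun (x : α) (s : ℝ) =>
      ‖f (ι u x + s * ι v x) - g x‖ₑ * ‖ι v x‖ₑ) := by
    have h1 : Measurable (ι u) := (Lp.stronglyMeasurable _).measurable
    have h2 : Measurable (ι v) := (Lp.stronglyMeasurable _).measurable
    have h3 : Measurable g := (Lp.stronglyMeasurable _).measurable
    have h4 := hf.measurable
    unfold Function.uncurry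
    fun_prop
  calc ∫⁻ x, ‖primitive f (ι (u + v) x) - primitive f (ι u x) - g x * ι v x‖ₑ ∂μ
      ≤ ∫⁻ x, (∫⁻ s : ℝ in Set.Icc (0 : ℝ) 1,
        ‖f (ι u x + s * ι v x) - g x‖ₑ * ‖ι v x‖ₑ) ∂μ := by
        refine lintegral_mono_ae ?_
        filter_upwards [hadd 1] with x hx
        rw [one_smul, one_mul] at hx
        rw [hx]
        exact enorm_primitive_add_sub_le hf _ _ _
    _ = ∫⁻ s : ℝ in Set.Icc (0 : ℝ) 1, ∫⁻ x, ‖f (ι u x + s * ι v x) - g x‖ₑ * ‖ι v x‖ₑ ∂μ :=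
        lintegral_lintegral_swap hm.aemeasurable
    _ ≤ ∫⁻ _ : ℝ in Set.Icc (0 : ℝ) 1, ENNReal.ofReal (A * ‖ι v‖) := by
        refine setLIntegral_mono measurable_const fun s hs => ?_
        set w := nemytskii h hf (u + s • v) - g with hw
        have hwx : ∀ᵐ x ∂μ, ‖f (ι u x + s * ι v x) - g x‖ₑ * ‖ι v x‖ₑ = ‖(w • ι v) x‖ₑ := by
          filter_upwards [hadd s, coeFn_nemytskii h hf (u + s • v),
            Lp.coeFn_sub (nemytskii h hf (u + s • v)) g, Lp.coeFn_lpSMul (r := 1) w (ι v)]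
            with x h1 h2 h3 h4
          rw [h4, Pi.smul_apply', hw, h3, Pi.sub_apply, h2, h1, smul_eq_mul, enorm_mul]
        rw [lintegral_congr_ae hwx, ← eLpNorm_one_eq_lintegral_enorm,
          ← ENNReal.ofReal_toReal (Lp.eLpNorm_ne_top _), ← Lp.norm_def]
        refine ENNReal.ofReal_le_ofReal ((Lp.norm_smul_le w (ι v)).trans ?_)
        gcongr
        exact hA s hs
    _ = _ := by simp

/-- `F(ι u)` is the Taylor remainder of the primitive at `0` with linear part `0`. -/
theorem BoundedSubstitution.integrable_primitive (h : BoundedSubstitution ι f)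
    (hf : Continuous f) (u : X) : Integrable (fun x => primitive f (ι u x)) μ := by
  refine ⟨aestronglyMeasurable_comp_Lp (continuous_primitive hf) _, ?_⟩
  obtain ⟨D, hD⟩ := exists_norm_nemytskii_le h hf ‖u‖
  have := lintegral_primitive_remainder_le h hf 0 u 0 (A := D) fun s hs => by
    rw [zero_add, sub_zero]
    refine hD _ ?_
    rw [norm_smul, Real.norm_of_nonneg hs.1]
    exact mul_le_of_le_one_left (norm_nonneg _) hs.2
  refine lt_of_le_of_lt (le_of_eq_of_le ?_ this) ENNReal.ofReal_lt_top
  refine lintegral_congr_ae ?_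
  filter_upwards [Lp.coeFn_zero ℝ 2 μ] with x hx
  rw [zero_add, map_zero, hx]
  simp [primitive]

/-- The derivative of `u ↦ ∫ F(ι u)` is `v ↦ ∫ f(ι u) ι v`: the remainder is at most the oscillation
of `f(ι ·)` in `L²` on the segment from `u` to `u + v`, times `‖ι v‖`. -/
theorem hasFDerivAt_integral_primitive (h : BoundedSubstitution ι f) (hf : Continuous f) (u : X) :
    HasFDerivAt (fun u => ∫ x, primitive f (ι u x) ∂μ)
      ((innerSL ℝ (nemytskii h hf u)).comp ι) u := by
  rw [hasFDerivAt_iff_isLittleO_nhds_zero, Asymptotics.isLittleO_iff]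
  intro ε hε
  obtain ⟨δ, hδ, hcont⟩ := Metric.continuousAt_iff.1 (continuous_nemytskii h hf).continuousAt
    (ε / (‖ι‖ + 1)) (by positivity)
  filter_upwards [Metric.ball_mem_nhds (0 : X) hδ] with v hv
  rw [mem_ball_zero_iff] at hv
  have hrem := lintegral_primitive_remainder_le h hf u v (nemytskii h hf u)
    (A := ε / (‖ι‖ + 1)) fun s hs => by
      rw [← dist_eq_norm]
      refine (hcont ?_).le
      rw [dist_self_add_left, norm_smul, Real.norm_of_nonneg hs.1]
      exact (mul_le_of_le_one_left (norm_nonneg _) hs.2).trans_lt hv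
  have hinner : Integrable (fun x => nemytskii h hf u x * ι v x) μ := by
    simpa [mul_comm] using L2.integrable_inner (𝕜 := ℝ) (nemytskii h hf u) (ι v)
  have heq : (∫ x, primitive f (ι (u + v) x) ∂μ) - (∫ x, primitive f (ι u x) ∂μ) -
      ((innerSL ℝ (nemytskii h hf u)).comp ι) v =
      ∫ x, (primitive f (ι (u + v) x) - primitive f (ι u x) - nemytskii h hf u x * ι v x) ∂μ := by
    have hi := h.integrable_primitive hf
    have hi' : Integrable (fun x => primitive f (ι (u + v) x) - primitive f (ι u x)) μ :=
      (hi _).sub (hi _)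
    rw [integral_sub hi' hinner, integral_sub (hi _) (hi _)]
    congr 1
    simp only [ContinuousLinearMap.comp_apply, innerSL_apply_apply, L2.inner_def]
    refine integral_congr_ae (Eventually.of_forall fun x => ?_)
    simp [mul_comm]
  rw [heq, ← ENNReal.ofReal_le_ofReal_iff (by positivity), ofReal_norm]
  refine (enorm_integral_le_lintegral_enorm _).trans (hrem.trans (ENNReal.ofReal_le_ofReal ?_))
  calc ε / (‖ι‖ + 1) * ‖ι v‖ ≤ ε / (‖ι‖ + 1) * ((‖ι‖ + 1) * ‖v‖) := by
        gcongr
        exact (ι.le_opNorm v).trans (by gcongr; linarith)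
    _ = ε * ‖v‖ := by field_simp

end Nemytskii

/-! ### The Palais–Smale condition in Hilbert space -/

section AbstractPalaisSmale

variable {H K : Type*} [NormedAddCommGroup H] [InnerProductSpace ℝ H]
  [NormedAddCommGroup K] [InnerProductSpace ℝ K]

/-- A sequential form of compactness of a linear map: images of bounded sequences have Cauchy
subsequences. -/
def SequentiallyCompactMap (ι : H →L[ℝ] K) : Prop :=
  ∀ (u : ℕ → H) (M : ℝ), (∀ n, ‖u n‖ ≤ M) →
    ∃ k : ℕ → ℕ, StrictMono k ∧ CauchySeq fun n => ι (u (k n))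

/-- Schauder's theorem in Hilbert spaces: `‖ι† g‖² = ⟪ι ι† g, g⟫ ≤ ‖ι (ι† g)‖ ‖g‖`. -/
theorem SequentiallyCompactMap.adjoint [CompleteSpace H] [CompleteSpace K]
    {ι : H →L[ℝ] K} (hι : SequentiallyCompactMap ι) :
    SequentiallyCompactMap (ContinuousLinearMap.adjoint ι) := by
  intro g M hg
  set T := ContinuousLinearMap.adjoint ι
  obtain ⟨k, hk, hc⟩ := hι (fun n => T (g n)) (‖T‖ * M) fun n =>
    (T.le_opNorm _).trans (by gcongr; exact hg n)
  refine ⟨k, hk, ?_⟩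
  have hM : 0 ≤ M := (norm_nonneg _).trans (hg 0)
  have hsq : ∀ m n, ‖T (g (k m)) - T (g (k n))‖ ^ 2 ≤
      ‖ι (T (g (k m))) - ι (T (g (k n)))‖ * (2 * M) := by
    intro m n
    rw [← map_sub, ← map_sub, ← map_sub, ← real_inner_self_eq_norm_sq,
      ContinuousLinearMap.adjoint_inner_right]
    refine (real_inner_le_norm _ _).trans ?_
    gcongr
    linarith [norm_sub_le (g (k m)) (g (k n)), hg (k m), hg (k n)]
  rw [Metric.cauchySeq_iff] at hc ⊢
  intro ε hε
  obtain ⟨n₀, hn₀⟩ := hc (ε ^ 2 / (2 * M + 1)) (by positivity)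
  refine ⟨n₀, fun m hm n hn => ?_⟩
  have h1 := hn₀ m hm n hn
  rw [dist_eq_norm, lt_div_iff₀ (by positivity)] at h1
  rw [dist_eq_norm]
  refine lt_of_pow_lt_pow_left₀ 2 hε.le (lt_of_le_of_lt (hsq m n) (lt_of_le_of_lt ?_ h1))
  gcongr
  linarith

variable {α : Type*} [MeasurableSpace α] {μ : Measure α} [IsFiniteMeasure μ]
  {ι : H →L[ℝ] Lp ℝ 2 μ} {f : ℝ → ℝ}

/-- The functional `½‖u‖² - ∫ F(ι u)` on a Hilbert space `H` mapped into `L²`. -/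
noncomputable def abstractEnergy (ι : H →L[ℝ] Lp ℝ 2 μ) (f : ℝ → ℝ) (u : H) : ℝ :=
  (1 / 2 : ℝ) * ‖u‖ ^ 2 - ∫ x, primitive f (ι u x) ∂μ

theorem hasFDerivAt_abstractEnergy (h : BoundedSubstitution ι f) (hf : Continuous f) (u : H) :
    HasFDerivAt (abstractEnergy ι f)
      (innerSL ℝ u - (innerSL ℝ (nemytskii h hf u)).comp ι) u := by
  have h1 : HasFDerivAt (fun u : H => (1 / 2 : ℝ) * ‖u‖ ^ 2) (innerSL ℝ u) u := by
    refine (((hasStrictFDerivAt_norm_sq u).hasFDerivAt).const_mul (1 / 2 : ℝ)).congr_fderiv ?_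
    ext v
    simp
  exact h1.sub (hasFDerivAt_integral_primitive h hf u)

theorem contDiff_abstractEnergy (h : BoundedSubstitution ι f) (hf : Continuous f) :
    ContDiff ℝ 1 (abstractEnergy ι f) := by
  rw [contDiff_one_iff_fderiv]
  refine ⟨fun u => (hasFDerivAt_abstractEnergy h hf u).differentiableAt, ?_⟩
  rw [show fderiv ℝ (abstractEnergy ι f) = fun u => innerSL ℝ u -
    (innerSL ℝ (nemytskii h hf u)).comp ι from
      funext fun u => (hasFDerivAt_abstractEnergy h hf u).fderiv]
  have := continuous_nemytskii h hf
  fun_prop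

/-- The Ambrosetti–Rabinowitz inequality bounds `‖u‖²` by `E(u) - E'(u)u / (2 + γ)`. -/
theorem norm_sq_le_of_ambrosettiRabinowitz (h : BoundedSubstitution ι f) (hf : Continuous f)
    {γ : ℝ} (hAR : ∀ s : ℝ, s ≠ 0 → (2 + γ) * primitive f s ≤ f s * s) (u : H) :
    γ / 2 * ‖u‖ ^ 2 ≤ (2 + γ) * abstractEnergy ι f u - fderiv ℝ (abstractEnergy ι f) u u := by
  have hi := (h.integrable_primitive hf u).const_mul (2 + γ)
  have hmono : ∫ x, (2 + γ) * primitive f (ι u x) ∂μ ≤ inner ℝ (nemytskii h hf u) (ι u) := by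
    rw [L2.inner_def]
    refine integral_mono_ae hi (L2.integrable_inner _ _) ?_
    filter_upwards [coeFn_nemytskii h hf u] with x hx
    rw [hx]
    by_cases h0 : ι u x = 0
    · simp [h0, primitive]
    · simpa [mul_comm] using hAR _ h0
  rw [integral_const_mul] at hmono
  rw [(hasFDerivAt_abstractEnergy h hf u).fderiv]
  simp only [abstractEnergy, sub_apply, ContinuousLinearMap.comp_apply,
    innerSL_apply_apply, real_inner_self_eq_norm_sq]
  linarith

/-- Palais–Smale sequences are bounded, and `u = E'(u) + ι† f(u)` up to the Riesz isomorphism, where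
`ι†` is compact and `f(u)` remains bounded in `L²`. -/
theorem palaisSmale_abstractEnergy [CompleteSpace H] (h : BoundedSubstitution ι f) (hf : Continuous f)
    (hι : SequentiallyCompactMap ι) (hAR : AmbrosettiRabinowitz f) :
    PalaisSmale (abstractEnergy ι f) := by
  intro d u hd hd'
  set J := abstractEnergy ι f
  obtain ⟨γ, hγ, hAR⟩ := hAR
  obtain ⟨A, hA⟩ := hd.norm.isBoundedUnder_le.bddAbove_range
  obtain ⟨B, hB⟩ := hd'.norm.isBoundedUnder_le.bddAbove_range
  replace hA : ∀ n, J (u n) ≤ A := fun n => (le_abs_self _).trans (hA ⟨n, rfl⟩)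
  replace hB : ∀ n, ‖fderiv ℝ J (u n)‖ ≤ B := fun n => hB ⟨n, rfl⟩
  have hA0 : ∀ n, γ / 2 * ‖u n‖ ^ 2 ≤ (2 + γ) * A + B * ‖u n‖ := by
    intro n
    have h1 := norm_sq_le_of_ambrosettiRabinowitz h hf (fun s hs => (hAR s hs).1) (u n)
    have h2 : -(fderiv ℝ J (u n) (u n)) ≤ B * ‖u n‖ :=
      (neg_le_abs _).trans (((fderiv ℝ J (u n)).le_opNorm _).trans (by gcongr; exact hB n))
    have h3 : (2 + γ) * J (u n) ≤ (2 + γ) * A := by gcongr; exact hA n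
    linarith
  -- A quadratic inequality `γ/2 t² ≤ a + B t` bounds `t`.
  have hbd : ∃ M, ∀ n, ‖u n‖ ≤ M := by
    refine ⟨1 + 2 / γ * (|(2 + γ) * A| + |B|), fun n => ?_⟩
    by_contra! hlt
    set t := ‖u n‖
    have ht1 : 1 ≤ t := by
      have : 0 ≤ 2 / γ * (|(2 + γ) * A| + |B|) := by positivity
      linarith
    have h4 : |(2 + γ) * A| + |B| < γ / 2 * t := by
      have : 2 / γ * (|(2 + γ) * A| + |B|) < t := by linarith
      calc |(2 + γ) * A| + |B| = γ / 2 * (2 / γ * (|(2 + γ) * A| + |B|)) := by field_simp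
        _ < γ / 2 * t := by gcongr
    have h5 : (2 + γ) * A ≤ |(2 + γ) * A| * t :=
      (le_abs_self _).trans (le_mul_of_one_le_right (abs_nonneg _) ht1)
    have h6 : B * t ≤ |B| * t := by gcongr; exact le_abs_self B
    nlinarith [hA0 n]
  obtain ⟨M, hM⟩ := hbd
  obtain ⟨D, hD⟩ := exists_norm_nemytskii_le h hf M
  obtain ⟨k, hk, hcauchy⟩ := hι.adjoint (fun n => nemytskii h hf (u n)) D fun n => hD _ (hM n)
  obtain ⟨v, hv⟩ := cauchySeq_tendsto_of_complete hcauchy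
  refine ⟨v, k, hk, ?_⟩
  -- `u` is the sum of the gradient of the energy, which tends to zero, and `ι† f(u)`.
  have hdec : ∀ w : H, (InnerProductSpace.toDual ℝ H).symm (fderiv ℝ J w) +
      ContinuousLinearMap.adjoint ι (nemytskii h hf w) = w := by
    intro w
    refine ext_inner_right ℝ fun z => ?_
    rw [inner_add_left, InnerProductSpace.toDual_symm_apply,
      ContinuousLinearMap.adjoint_inner_left, (hasFDerivAt_abstractEnergy h hf w).fderiv]
    simp
  have hzero : Tendsto (fun n => (InnerProductSpace.toDual ℝ H).symm (fderiv ℝ J (u (k n))))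
      atTop (𝓝 0) := by
    have := ((InnerProductSpace.toDual ℝ H).symm.continuous.tendsto 0).comp
      (hd'.comp hk.tendsto_atTop)
    simpa [Function.comp_def] using this
  simpa [hdec] using hzero.add hv

end AbstractPalaisSmale

/-! ### Integrals and test functions -/

section Tools

variable {α : Type*} [MeasurableSpace α] {μ : Measure α}

/-- The Cauchy–Schwarz inequality against the constant function `1`. -/
theorem sq_lintegral_le (g : α → ℝ≥0∞) (hg : AEMeasurable g μ) :
    (∫⁻ x, g x ∂μ) ^ 2 ≤ μ Set.univ * ∫⁻ x, g x ^ 2 ∂μ := by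
  have h := ENNReal.lintegral_mul_le_Lp_mul_Lq μ Real.HolderConjugate.two_two hg
    (aemeasurable_const (b := (1 : ℝ≥0∞)))
  simp only [Pi.mul_apply, mul_one, lintegral_const,
    ENNReal.rpow_two, one_pow, one_mul] at h
  have hs : ∀ a : ℝ≥0∞, (a ^ (1 / 2 : ℝ)) ^ 2 = a := fun a => by
    rw [← ENNReal.rpow_natCast, ← ENNReal.rpow_mul]
    norm_num
  calc (∫⁻ x, g x ∂μ) ^ 2 ≤ _ := pow_le_pow_left' h 2
    _ = _ := by rw [mul_pow, hs, hs, mul_comm]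

theorem eLpNorm_two_sq {F : Type*} [NormedAddCommGroup F] (h : α → F) :
    eLpNorm h 2 μ ^ 2 = ∫⁻ x, ‖h x‖ₑ ^ 2 ∂μ := by
  have := eLpNorm_nnreal_pow_eq_lintegral (μ := μ) (f := h) (p := 2) (by simp)
  simpa using this

variable {N : ℕ} {Ω : BoundedDomain N} {φ : EuclideanSpace ℝ (Fin N) → ℝ}

theorem IsTestFunction.contDiff_one (hφ : IsTestFunction Ω φ) : ContDiff ℝ 1 φ :=
  hφ.smooth.of_le (by simp)

theorem IsTestFunction.continuous (hφ : IsTestFunction Ω φ) : Continuous φ :=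
  hφ.smooth.continuous

theorem IsTestFunction.eq_zero (hφ : IsTestFunction Ω φ) {x} (hx : x ∉ Ω.carrier) : φ x = 0 :=
  image_eq_zero_of_notMem_tsupport fun h => hx (hφ.support h)

theorem IsTestFunction.support_subset (hφ : IsTestFunction Ω φ) : φ.support ⊆ Ω.carrier :=
  (subset_tsupport φ).trans hφ.support

theorem IsTestFunction.eLpNorm_fderiv (hφ : IsTestFunction Ω φ)
    {g : Lp (EuclideanSpace ℝ (Fin N)) 2 Ω.μ} (hg : g =ᵐ[Ω.μ] ∇ φ) :
    eLpNorm (fderiv ℝ φ) 2 volume = ENNReal.ofReal ‖g‖ := by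
  rw [Lp.norm_def, ENNReal.ofReal_toReal (Lp.eLpNorm_ne_top g), eLpNorm_congr_ae hg,
    ← eLpNorm_restrict_eq_of_support_subset (s := Ω.carrier) (f := fderiv ℝ φ)
      ((support_fderiv_subset ℝ).trans hφ.support)]
  exact eLpNorm_congr_norm_ae (Eventually.of_forall fun x => by simp [gradient])

end Tools

/-! ### Friedrichs' inequality and Rellich's theorem -/

section Friedrichs

variable {N : ℕ}

/-- Translations act on `C^1` functions with a Lipschitz bound in `L²`. -/
theorem lintegral_enorm_translate_sub_sq_le {φ : EuclideanSpace ℝ (Fin N) → ℝ}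
    (hφ : ContDiff ℝ 1 φ) (z : EuclideanSpace ℝ (Fin N)) :
    ∫⁻ x, ‖φ (x + z) - φ x‖ₑ ^ 2 ≤ ‖z‖ₑ ^ 2 * ∫⁻ x, ‖fderiv ℝ φ x‖ₑ ^ 2 := by
  have hc : Continuous (fderiv ℝ φ) := hφ.continuous_fderiv one_ne_zero
  have hpt : ∀ x, ‖φ (x + z) - φ x‖ₑ ^ 2 ≤
      ‖z‖ₑ ^ 2 * ∫⁻ s : ℝ in Set.Icc 0 1, ‖fderiv ℝ φ (x + s • z)‖ₑ ^ 2 := by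
    intro x
    have hder : ∀ s ∈ Set.uIcc (0 : ℝ) 1, HasDerivAt
        (fun s : ℝ => φ (x + s • z)) (fderiv ℝ φ (x + s • z) z) s := by
      intro s _
      have h1 : HasDerivAt (fun s : ℝ => x + s • z) z s := by
        simpa using ((hasDerivAt_id s).smul_const z).const_add x
      exact ((hφ.differentiable one_ne_zero) _).hasFDerivAt.comp_hasDerivAt s h1
    have hcs : Continuous fun s : ℝ => fderiv ℝ φ (x + s • z) z := by fun_prop
    have h2 := intervalIntegral.integral_eq_sub_of_hasDerivAt hder (hcs.intervalIntegrable _ _)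
    rw [one_smul, zero_smul, add_zero, intervalIntegral.integral_of_le zero_le_one,
      ← integral_Icc_eq_integral_Ioc] at h2
    rw [← h2]
    calc ‖∫ s in Set.Icc (0 : ℝ) 1, fderiv ℝ φ (x + s • z) z‖ₑ ^ 2
        ≤ (∫⁻ s : ℝ in Set.Icc 0 1, ‖fderiv ℝ φ (x + s • z) z‖ₑ) ^ 2 := by
          gcongr
          exact enorm_integral_le_lintegral_enorm _
      _ ≤ (volume.restrict (Set.Icc (0 : ℝ) 1)) Set.univ *
          ∫⁻ s : ℝ in Set.Icc 0 1, ‖fderiv ℝ φ (x + s • z) z‖ₑ ^ 2 :=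
          sq_lintegral_le _ hcs.enorm.measurable.aemeasurable
      _ = ∫⁻ s : ℝ in Set.Icc 0 1, ‖fderiv ℝ φ (x + s • z) z‖ₑ ^ 2 := by simp
      _ ≤ ∫⁻ s : ℝ in Set.Icc 0 1, ‖z‖ₑ ^ 2 * ‖fderiv ℝ φ (x + s • z)‖ₑ ^ 2 := by
          refine lintegral_mono fun s => ?_
          rw [← mul_pow, mul_comm]
          gcongr
          exact ContinuousLinearMap.le_opENorm _ _
      _ = _ := lintegral_const_mul' _ _ (by simp)
  have hm : Measurable (Function.uncurry fun (x : EuclideanSpace ℝ (Fin N)) (s : ℝ) =>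
      ‖fderiv ℝ φ (x + s • z)‖ₑ ^ 2) := by
    refine Measurable.pow_const (Continuous.measurable ?_) 2
    fun_prop
  calc ∫⁻ x, ‖φ (x + z) - φ x‖ₑ ^ 2
      ≤ ∫⁻ x, ‖z‖ₑ ^ 2 * ∫⁻ s : ℝ in Set.Icc 0 1, ‖fderiv ℝ φ (x + s • z)‖ₑ ^ 2 :=
        lintegral_mono hpt
    _ = ‖z‖ₑ ^ 2 * ∫⁻ s : ℝ in Set.Icc 0 1, ∫⁻ x, ‖fderiv ℝ φ (x + s • z)‖ₑ ^ 2 := by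
        rw [lintegral_const_mul' _ _ (by simp), lintegral_lintegral_swap hm.aemeasurable]
    _ = _ := by
        simp_rw [lintegral_add_right_eq_self (fun x => ‖fderiv ℝ φ x‖ₑ ^ 2)]
        simp

/-- The half-open cube of side `δ` with index `k` in the grid `δ ℤ^N`. -/
def cell (δ : ℝ) (k : Fin N → ℤ) : Set (EuclideanSpace ℝ (Fin N)) := {x | ∀ i, ⌊x i / δ⌋ = k i}

theorem measurableSet_cell (δ : ℝ) (k : Fin N → ℤ) : MeasurableSet (cell δ k) := by
  unfold cell
  simp only [Set.ofPred_forall]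
  refine MeasurableSet.iInter fun i => ?_
  have : Measurable fun x : EuclideanSpace ℝ (Fin N) => ⌊x i / δ⌋ := by fun_prop
  exact this (measurableSet_singleton (k i))

theorem pairwise_disjoint_cell (δ : ℝ) :
    Pairwise (Function.onFun Disjoint (cell δ : (Fin N → ℤ) → _)) := by
  intro k l hkl
  refine Set.disjoint_left.2 fun x hx hy => hkl (funext fun i => ?_)
  rw [← hx i, ← hy i]

theorem volume_cell {δ : ℝ} (hδ : 0 < δ) (k : Fin N → ℤ) :
    volume (cell δ k) = ENNReal.ofReal (δ ^ N) := by
  have h : cell δ k = (WithLp.ofLp : EuclideanSpace ℝ (Fin N) → _) ⁻¹'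
      Set.pi Set.univ fun i => Set.Ico (k i * δ) ((k i + 1) * δ) := by
    ext x
    simp only [cell, Set.mem_ofPred_eq, Set.mem_preimage, Set.mem_pi, Set.mem_univ, true_imp_iff,
      Set.mem_Ico, Int.floor_eq_iff, le_div_iff₀ hδ, div_lt_iff₀ hδ]
  rw [h, (PiLp.volume_preserving_ofLp (Fin N)).measure_preimage
    (MeasurableSet.univ_pi fun i => measurableSet_Ico).nullMeasurableSet, Real.volume_pi_Ico]
  have : ∀ i, ((k i : ℝ) + 1) * δ - k i * δ = δ := fun i => by ring
  simp [this, ENNReal.ofReal_pow hδ.le]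

theorem dist_le_of_mem_cell {δ : ℝ} (hδ : 0 < δ) {k : Fin N → ℤ}
    {x y : EuclideanSpace ℝ (Fin N)} (hx : x ∈ cell δ k) (hy : y ∈ cell δ k) :
    dist y x ≤ √N * δ := by
  have hi : ∀ i, dist (y i) (x i) ^ 2 ≤ δ ^ 2 := by
    intro i
    have h : |y i / δ - x i / δ| < 1 :=
      Int.abs_sub_lt_one_of_floor_eq_floor ((hy i).trans (hx i).symm)
    rw [← sub_div, abs_div, abs_of_pos hδ, div_lt_one hδ] at h
    rw [Real.dist_eq]
    gcongr
  rw [EuclideanSpace.dist_eq, ← Real.sqrt_sq hδ.le, ← Real.sqrt_mul (by positivity)]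
  refine Real.sqrt_le_sqrt ((Finset.sum_le_sum fun i _ => hi i).trans_eq ?_)
  simp

theorem exists_finset_cell_cover {δ : ℝ} (hδ : 0 < δ) {s : Set (EuclideanSpace ℝ (Fin N))}
    (hs : Bornology.IsBounded s) :
    ∃ S : Finset (Fin N → ℤ), ∀ x ∈ s, ∃ k ∈ S, x ∈ cell δ k := by
  obtain ⟨R, hR⟩ := hs.exists_norm_le
  refine ⟨Fintype.piFinset fun _ => Finset.Icc ⌊-R / δ⌋ ⌊R / δ⌋, fun x hx => ?_⟩
  refine ⟨fun i => ⌊x i / δ⌋, ?_, fun i => rfl⟩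
  rw [Fintype.mem_piFinset]
  intro i
  have h := abs_le.1 (((Real.norm_eq_abs _).symm.trans_le (PiLp.norm_apply_le x i)).trans (hR x hx))
  rw [Finset.mem_Icc]
  exact ⟨Int.floor_le_floor (by gcongr; exact h.1), Int.floor_le_floor (by gcongr; exact h.2)⟩

/-- The `L²` mass with respect to a finite measure is split into mean value and oscillation. -/
theorem two_mul_integral_sq_eq {α : Type*} [MeasurableSpace α] {ν : Measure α} [IsFiniteMeasure ν]
    {φ : α → ℝ} (hi : Integrable φ ν) (hi2 : Integrable (fun x => φ x ^ 2) ν) :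
    2 * ν.real Set.univ * ∫ x, φ x ^ 2 ∂ν = 2 * (∫ x, φ x ∂ν) ^ 2 +
      (∫⁻ x, ∫⁻ y, ‖φ y - φ x‖ₑ ^ 2 ∂ν ∂ν).toReal := by
  set c := ν.real Set.univ with hc
  set I := ∫ x, φ x ∂ν with hI
  set J := ∫ x, φ x ^ 2 ∂ν with hJ
  have hinner : ∀ x, Integrable (fun y => (φ y - φ x) ^ 2) ν ∧
      ∫ y, (φ y - φ x) ^ 2 ∂ν = J - 2 * φ x * I + c * φ x ^ 2 := by
    intro x
    have h1 : ∀ y, (φ y - φ x) ^ 2 = φ y ^ 2 - 2 * φ x * φ y + φ x ^ 2 := fun y => by ring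
    have h2 : Integrable (fun y => φ y ^ 2 - 2 * φ x * φ y) ν := hi2.sub (hi.const_mul _)
    simp only [h1]
    refine ⟨h2.add (integrable_const _), ?_⟩
    rw [integral_add h2 (integrable_const _), integral_sub hi2 (hi.const_mul _),
      integral_const_mul, integral_const, smul_eq_mul]
  have hnonneg : ∀ x, 0 ≤ J - 2 * φ x * I + c * φ x ^ 2 := by
    intro x
    rw [← (hinner x).2]
    exact integral_nonneg fun y => sq_nonneg _
  have hlin : ∀ x, ∫⁻ y, ‖φ y - φ x‖ₑ ^ 2 ∂ν =
      ENNReal.ofReal (J - 2 * φ x * I + c * φ x ^ 2) := by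
    intro x
    rw [← (hinner x).2, ofReal_integral_eq_lintegral_ofReal (hinner x).1
      (Eventually.of_forall fun y => sq_nonneg _)]
    refine lintegral_congr fun y => ?_
    rw [← ofReal_norm, ← ENNReal.ofReal_pow (norm_nonneg _), Real.norm_eq_abs, sq_abs]
  have hlinear : Integrable (fun x => 2 * φ x * I) ν := (hi.const_mul 2).mul_const I
  have hout : Integrable (fun x => J - 2 * φ x * I) ν := (integrable_const _).sub hlinear
  have hq : Integrable (fun x => c * φ x ^ 2) ν := hi2.const_mul c
  have htot : ∫ x, (J - 2 * φ x * I + c * φ x ^ 2) ∂ν = 2 * c * J - 2 * I ^ 2 := by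
    rw [integral_add hout hq, integral_sub (integrable_const _) hlinear, integral_const,
      integral_const_mul, integral_mul_const, integral_const_mul, smul_eq_mul, ← hc, ← hI, ← hJ]
    ring
  simp_rw [hlin]
  rw [← ofReal_integral_eq_lintegral_ofReal
    (f := fun x => J - 2 * φ x * I + c * φ x ^ 2) (hout.add hq) (Eventually.of_forall hnonneg),
    ENNReal.toReal_ofReal (integral_nonneg hnonneg), htot]
  ring

/-- The total oscillation over all cells is controlled by the gradient: two points of a cell differ
by a vector `z` of length at most `√N δ`, so the sum is at most an integral over `z` of the translation
estimate. -/
theorem sum_lintegral_cell_le {φ : EuclideanSpace ℝ (Fin N) → ℝ} (hφ : ContDiff ℝ 1 φ)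
    {δ : ℝ} (hδ : 0 < δ) (S : Finset (Fin N → ℤ)) :
    ∑ k ∈ S, ∫⁻ x in cell δ k, ∫⁻ y in cell δ k, ‖φ y - φ x‖ₑ ^ 2 ≤
      ENNReal.ofReal ((√N * δ) ^ 2) * (∫⁻ x, ‖fderiv ℝ φ x‖ₑ ^ 2) *
        volume (Metric.closedBall (0 : EuclideanSpace ℝ (Fin N)) (√N * δ)) := by
  set r := √N * δ
  have hr : 0 ≤ r := by positivity
  have hc := hφ.continuous
  have hball : ∀ x : EuclideanSpace ℝ (Fin N), ∫⁻ y in Metric.closedBall x r, ‖φ y - φ x‖ₑ ^ 2 =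
      ∫⁻ z in Metric.closedBall 0 r, ‖φ (x + z) - φ x‖ₑ ^ 2 := by
    intro x
    rw [← (measurePreserving_add_left volume x).setLIntegral_comp_preimage
      Metric.isClosed_closedBall.measurableSet
      (f := fun y => ‖φ y - φ x‖ₑ ^ 2) (Continuous.measurable (by fun_prop))]
    congr 2
    ext z
    simp
  have hm : Measurable (Function.uncurry fun (x z : EuclideanSpace ℝ (Fin N)) =>
      ‖φ (x + z) - φ x‖ₑ ^ 2) := by
    refine Measurable.pow_const (Continuous.measurable ?_) 2
    fun_prop
  calc ∑ k ∈ S, ∫⁻ x in cell δ k, ∫⁻ y in cell δ k, ‖φ y - φ x‖ₑ ^ 2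
      ≤ ∑ k ∈ S, ∫⁻ x in cell δ k, ∫⁻ y in Metric.closedBall x r, ‖φ y - φ x‖ₑ ^ 2 := by
        refine Finset.sum_le_sum fun k _ => setLIntegral_mono' (measurableSet_cell δ k)
          fun x hx => lintegral_mono_set fun y hy => dist_le_of_mem_cell hδ hx hy
    _ = ∫⁻ x in ⋃ k ∈ S, cell δ k, ∫⁻ y in Metric.closedBall x r, ‖φ y - φ x‖ₑ ^ 2 :=
        (lintegral_biUnion_finset ((pairwise_disjoint_cell δ).set_pairwise _)
          (fun k _ => measurableSet_cell δ k) _).symm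
    _ ≤ ∫⁻ x, ∫⁻ y in Metric.closedBall x r, ‖φ y - φ x‖ₑ ^ 2 := setLIntegral_le_lintegral _ _
    _ = ∫⁻ z in Metric.closedBall 0 r, ∫⁻ x, ‖φ (x + z) - φ x‖ₑ ^ 2 := by
        simp_rw [hball]
        exact lintegral_lintegral_swap hm.aemeasurable
    _ ≤ ∫⁻ _ in Metric.closedBall (0 : EuclideanSpace ℝ (Fin N)) r,
          ENNReal.ofReal (r ^ 2) * ∫⁻ x, ‖fderiv ℝ φ x‖ₑ ^ 2 := by
        refine setLIntegral_mono measurable_const fun z hz => ?_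
        refine (lintegral_enorm_translate_sub_sq_le hφ z).trans ?_
        rw [← ofReal_norm, ← ENNReal.ofReal_pow (norm_nonneg _)]
        gcongr
        exact mem_closedBall_zero_iff.1 hz
    _ = _ := by rw [lintegral_const, Measure.restrict_apply_univ]

variable {Ω : BoundedDomain N}

theorem IsTestFunction.inner_indicatorConstLp {φ : EuclideanSpace ℝ (Fin N) → ℝ}
    (hφ : IsTestFunction Ω φ) {u : Lp ℝ 2 Ω.μ} (hu : u =ᵐ[Ω.μ] φ)
    {Q : Set (EuclideanSpace ℝ (Fin N))} (hQ : MeasurableSet Q) :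
    inner ℝ (indicatorConstLp 2 hQ (measure_ne_top Ω.μ _) (1 : ℝ)) u = ∫ x in Q, φ x := by
  rw [L2.inner_indicatorConstLp_one, integral_congr_ae (ae_restrict_of_ae hu),
    Measure.restrict_restrict hQ]
  exact (setIntegral_eq_of_subset_of_forall_sdiff_eq_zero hQ
    Set.inter_subset_left fun x hx => hφ.eq_zero fun h => hx.2 ⟨hx.1, h⟩).symm

theorem IsTestFunction.integrable {φ : EuclideanSpace ℝ (Fin N) → ℝ}
    (hφ : IsTestFunction Ω φ) : Integrable φ volume :=
  hφ.continuous.integrable_of_hasCompactSupport hφ.compact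

theorem IsTestFunction.integrable_sq {φ : EuclideanSpace ℝ (Fin N) → ℝ}
    (hφ : IsTestFunction Ω φ) : Integrable (fun x => φ x ^ 2) volume := by
  simp only [sq]
  exact (hφ.continuous.mul hφ.continuous).integrable_of_hasCompactSupport hφ.compact.mul_right

theorem IsTestFunction.norm_sq_eq_sum {φ : EuclideanSpace ℝ (Fin N) → ℝ}
    (hφ : IsTestFunction Ω φ) {u : Lp ℝ 2 Ω.μ} (hu : u =ᵐ[Ω.μ] φ) {δ : ℝ}
    {S : Finset (Fin N → ℤ)} (hS : ∀ x ∈ Ω.carrier, ∃ k ∈ S, x ∈ cell δ k) :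
    ‖u‖ ^ 2 = ∑ k ∈ S, ∫ x in cell δ k, φ x ^ 2 := by
  rw [← integral_biUnion_finset S (fun k _ => measurableSet_cell δ k)
    ((pairwise_disjoint_cell δ).set_pairwise _) fun k _ => hφ.integrable_sq.integrableOn,
    ← real_inner_self_eq_norm_sq, L2.inner_def]
  have h1 : ∫ x, inner ℝ (u x) (u x) ∂Ω.μ = ∫ x in Ω.carrier, φ x ^ 2 := by
    refine integral_congr_ae ?_
    filter_upwards [hu] with x hx
    rw [hx]
    simp [sq]
  rw [h1]
  refine (setIntegral_eq_of_subset_of_forall_sdiff_eq_zero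
    (Finset.measurableSet_biUnion _ fun k _ => measurableSet_cell δ k) (fun x hx => ?_)
    fun x hx => ?_).symm
  · obtain ⟨k, hk, hxk⟩ := hS x hx
    exact Set.mem_biUnion hk hxk
  · simp [hφ.eq_zero hx.2]

/-- **Friedrichs' inequality**: up to finitely many linear functionals, the `L²` norm is an
arbitrarily small multiple of the gradient norm. -/
theorem exists_friedrichs (Ω : BoundedDomain N) {ε : ℝ} (hε : 0 < ε) :
    ∃ (a : ℝ) (S : Finset (Fin N → ℤ)) (g : (Fin N → ℤ) → Lp ℝ 2 Ω.μ), ∀ w ∈ testGraph Ω,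
      ‖w.1‖ ^ 2 ≤ a * ∑ k ∈ S, (inner ℝ (g k) w.1) ^ 2 + ε * ‖w.2‖ ^ 2 := by
  set V := volume.real (Metric.ball (0 : EuclideanSpace ℝ (Fin N)) 1)
  have hV : 0 ≤ V := measureReal_nonneg
  set K : ℝ := N * √N ^ N * V with hK
  have hK0 : 0 ≤ K := by positivity
  -- The cell size is chosen such that `K δ² ≤ ε`, where `K` is the volume of a ball of radius `√N δ`
  -- relative to that of a cell, times `N`.
  set δ : ℝ := √(ε / (K + 1)) with hδ_def
  have hδ : 0 < δ := Real.sqrt_pos.2 (by positivity)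
  have hδ2 : K * δ ^ 2 ≤ ε := by
    rw [hδ_def, Real.sq_sqrt (by positivity), mul_div_assoc', div_le_iff₀ (by positivity)]
    nlinarith
  obtain ⟨S, hS⟩ := exists_finset_cell_cover hδ Ω.isBounded
  refine ⟨(δ ^ N)⁻¹, S, fun k => indicatorConstLp 2 (measurableSet_cell δ k)
    (measure_ne_top _ _) 1, ?_⟩
  rintro ⟨u, g⟩ ⟨φ, hφ, hu, hg⟩
  simp only at hu hg ⊢
  set G := ∑ k ∈ S, ∫⁻ x in cell δ k, ∫⁻ y in cell δ k, ‖φ y - φ x‖ₑ ^ 2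
  have hGle : G ≤ ENNReal.ofReal (δ ^ N * (ε * ‖g‖ ^ 2)) := by
    refine (sum_lintegral_cell_le hφ.contDiff_one hδ S).trans ?_
    rw [← eLpNorm_two_sq, hφ.eLpNorm_fderiv hg, Measure.addHaar_closedBall _ _ (by positivity),
      ← ENNReal.ofReal_toReal (measure_ne_top_of_subset Metric.ball_subset_closedBall
        (isCompact_closedBall (0 : EuclideanSpace ℝ (Fin N)) 1).measure_lt_top.ne),
      ← ENNReal.ofReal_pow (norm_nonneg _), ← ENNReal.ofReal_mul (by positivity),
      ← ENNReal.ofReal_mul (by positivity), ← ENNReal.ofReal_mul (by positivity)]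
    refine ENNReal.ofReal_le_ofReal ?_
    rw [finrank_euclideanSpace_fin, mul_pow, mul_pow, Real.sq_sqrt (by positivity)]
    calc (N : ℝ) * δ ^ 2 * ‖g‖ ^ 2 * (√N ^ N * δ ^ N * V)
        = δ ^ N * ((K * δ ^ 2) * ‖g‖ ^ 2) := by rw [hK]; ring
      _ ≤ δ ^ N * (ε * ‖g‖ ^ 2) := by gcongr
  have hterm : ∀ k ∈ S, (∫⁻ x in cell δ k, ∫⁻ y in cell δ k, ‖φ y - φ x‖ₑ ^ 2) ≠ ⊤ :=
    fun k hk => ((Finset.single_le_sum (fun _ _ => zero_le) hk).trans_lt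
      (hGle.trans_lt ENNReal.ofReal_lt_top)).ne
  have hsum : 2 * δ ^ N * ‖u‖ ^ 2 = 2 * ∑ k ∈ S, (∫ x in cell δ k, φ x) ^ 2 + G.toReal := by
    rw [hφ.norm_sq_eq_sum hu hS, ENNReal.toReal_sum hterm, Finset.mul_sum, Finset.mul_sum,
      ← Finset.sum_add_distrib]
    refine Finset.sum_congr rfl fun k _ => ?_
    have hfin : IsFiniteMeasure (volume.restrict (cell δ k)) := ⟨by simp [volume_cell hδ]⟩
    have hreal : (volume.restrict (cell δ k)).real Set.univ = δ ^ N := by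
      rw [Measure.real, Measure.restrict_apply_univ, volume_cell hδ,
        ENNReal.toReal_ofReal (by positivity)]
    have := two_mul_integral_sq_eq (ν := volume.restrict (cell δ k)) hφ.integrable.restrict
      hφ.integrable_sq.restrict
    rwa [hreal] at this
  have hGr : G.toReal ≤ δ ^ N * (ε * ‖g‖ ^ 2) :=
    ENNReal.toReal_le_of_le_ofReal (by positivity) hGle
  simp_rw [hφ.inner_indicatorConstLp hu]
  have hδN : 0 < δ ^ N := by positivity
  rw [← mul_le_mul_iff_right₀ hδN, mul_add, mul_inv_cancel_left₀ hδN.ne']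
  have : 0 ≤ δ ^ N * (ε * ‖g‖ ^ 2) := by positivity
  linarith

variable [N.AtLeastTwo]

/-- **Rellich's theorem**: the embedding `H^1_0(Ω) → L²(Ω)` is compact. -/
theorem sequentiallyCompactMap_valL (Ω : BoundedDomain N) :
    SequentiallyCompactMap (H01.valL Ω) := by
  intro u M hM
  -- A subsequence converges weakly in `L²(Ω)`.
  obtain ⟨C, hC⟩ := H01.exists_poincare Ω
  have : Fact ((2 : ℝ≥0∞) ≠ ⊤) := ⟨by simp⟩
  obtain ⟨ψ, -, k, hk, hlim⟩ := WeakDual.isSeqCompact_closedBall ℝ (Lp ℝ 2 Ω.μ) 0 (|C| * M)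
    (x := fun n => StrongDual.toWeakDual (innerSL ℝ (H01.val (u n)))) fun n => by
      simp only [Set.mem_preimage, mem_closedBall_zero_iff]
      change ‖innerSL ℝ (H01.val (u n))‖ ≤ _
      rw [innerSL_apply_norm]
      refine (hC _).trans ?_
      gcongr
      · exact le_abs_self C
      · exact hM n
  have hweak : ∀ g : Lp ℝ 2 Ω.μ, CauchySeq fun n => inner ℝ g (H01.val (u (k n))) := by
    intro g
    have h := (WeakDual.eval_continuous (𝕜 := ℝ) g).continuousAt.tendsto.comp hlim
    refine (h.congr fun n => ?_).cauchySeq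
    exact real_inner_comm g (H01.val (u (k n)))
  refine ⟨k, hk, ?_⟩
  have hM0 : 0 ≤ M := (norm_nonneg _).trans (hM 0)
  rw [Metric.cauchySeq_iff]
  intro ε hε
  set η := ε ^ 2 / (2 * (4 * M ^ 2 + 1)) with hη
  obtain ⟨a, S, g, hS⟩ := exists_friedrichs Ω (show 0 < η by positivity)
  have hall : ∀ v : H01 Ω, ‖H01.val v‖ ^ 2 ≤
      a * ∑ k ∈ S, (inner ℝ (g k) (H01.val v)) ^ 2 + η * ‖v‖ ^ 2 :=
    H01.induction_closed (P := fun w => ‖w.1‖ ^ 2 ≤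
      a * ∑ k ∈ S, (inner ℝ (g k) w.1) ^ 2 + η * ‖w.2‖ ^ 2)
      (isClosed_le (by fun_prop) (by fun_prop)) hS
  -- The finitely many functionals vanish in the limit by weak convergence.
  have hsmall : Tendsto (fun p : ℕ × ℕ => a * ∑ j ∈ S,
      (inner ℝ (g j) (H01.val (u (k p.1)) - H01.val (u (k p.2)))) ^ 2) atTop (𝓝 0) := by
    have hj : ∀ j, Tendsto (fun p : ℕ × ℕ =>
        (inner ℝ (g j) (H01.val (u (k p.1)) - H01.val (u (k p.2)))) ^ 2) atTop (𝓝 0) := by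
      intro j
      have h1 := cauchySeq_iff_tendsto_dist_atTop_0.1 (hweak (g j))
      refine ((h1.pow 2).congr fun p => ?_).trans_eq (by simp)
      rw [Real.dist_eq, sq_abs, inner_sub_right]
    simpa using (tendsto_finsetSum S fun j _ => hj j).const_mul a
  obtain ⟨⟨n₁, n₂⟩, hn⟩ := eventually_atTop.1
    (hsmall.eventually_lt_const (show 0 < ε ^ 2 / 2 by positivity))
  refine ⟨max n₁ n₂, fun m hm n hn' => ?_⟩
  have h1 := hn (m, n) ⟨(le_max_left _ _).trans hm, (le_max_right _ _).trans hn'⟩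
  have h2 := hall (u (k m) - u (k n))
  have h3 : ‖u (k m) - u (k n)‖ ≤ 2 * M :=
    (norm_sub_le _ _).trans (by linarith [hM (k m), hM (k n)])
  have h4 : η * ‖u (k m) - u (k n)‖ ^ 2 ≤ η * (2 * M) ^ 2 := by gcongr
  have h5 : η * (2 * M) ^ 2 < ε ^ 2 / 2 := by
    rw [hη, div_mul_eq_mul_div, div_lt_div_iff₀ (by positivity) (by positivity)]
    nlinarith [sq_pos_of_pos hε]
  rw [dist_eq_norm, H01.valL_apply, H01.valL_apply]
  refine lt_of_pow_lt_pow_left₀ 2 hε.le ?_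
  rw [map_sub] at h2
  linarith

end Friedrichs

/-! ### Trudinger's inequality in the plane -/

section Trudinger

/-- Outside `(0, 1)` the transition function attains its minimum or its maximum. -/
theorem deriv_smoothTransition_eq_zero {s : ℝ} (hs : s ≤ 0 ∨ 1 ≤ s) :
    deriv Real.smoothTransition s = 0 := by
  rcases hs with hs | hs
  · refine IsLocalMin.deriv_eq_zero (Eventually.of_forall fun y => ?_)
    rw [Real.smoothTransition.zero_of_nonpos hs]
    exact Real.smoothTransition.nonneg y
  · refine IsLocalMax.deriv_eq_zero (Eventually.of_forall fun y => ?_)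
    rw [Real.smoothTransition.one_of_one_le hs]
    exact Real.smoothTransition.le_one y

theorem exists_abs_deriv_smoothTransition_le :
    ∃ D : ℝ, 0 < D ∧ ∀ s, |deriv Real.smoothTransition s| ≤ D := by
  have hc : Continuous (deriv Real.smoothTransition) :=
    (Real.smoothTransition.contDiff (n := 1)).continuous_deriv le_rfl
  obtain ⟨D, hD⟩ := (isCompact_Icc (a := (0 : ℝ)) (b := 1)).exists_bound_of_continuousOn
    hc.continuousOn
  refine ⟨|D| + 1, by positivity, fun s => ?_⟩
  by_cases hs : s ∈ Set.Icc (0 : ℝ) 1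
  · exact (hD s hs).trans ((le_abs_self D).trans (by linarith))
  · rw [deriv_smoothTransition_eq_zero, abs_zero]
    · positivity
    · by_contra! h
      exact hs ⟨h.1.le, h.2.le⟩

theorem measure_superlevel_ne_top {N : ℕ} {φ : EuclideanSpace ℝ (Fin N) → ℝ}
    (hs : HasCompactSupport φ) {t : ℝ} (ht : 0 ≤ t) : volume {x | t < φ x} ≠ ⊤ :=
  measure_ne_top_of_subset (fun x hx => subset_tsupport φ
    (ne_of_gt (lt_of_le_of_lt ht hx) : φ x ≠ 0)) hs.isCompact.measure_lt_top.ne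

/-- The `L¹` Sobolev inequality in the plane, applied to a smooth truncation of `φ` between the
levels `t` and `t + h`, controls the decay of the distribution function. -/
theorem exists_superlevel_decay : ∃ L : ℝ≥0, 0 < L ∧
    ∀ φ : EuclideanSpace ℝ (Fin 2) → ℝ, ContDiff ℝ 1 φ → HasCompactSupport φ →
      ∀ t h : ℝ, 0 ≤ t → 0 < h →
        ENNReal.ofReal (h ^ 2) * volume {x | t + h < φ x} ≤
          L * (∫⁻ x in φ ⁻¹' Set.Ioc t (t + h), ‖fderiv ℝ φ x‖ₑ ^ 2) * volume {x | t < φ x} := by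
  obtain ⟨D, hD, hDle⟩ := exists_abs_deriv_smoothTransition_le
  lift D to ℝ≥0 using hD.le
  set K := eLpNormLESNormFDerivOneConst
    (volume : Measure (EuclideanSpace ℝ (Fin 2))) 2
  refine ⟨K ^ 2 * D ^ 2 + 1, by positivity, fun φ hφ hs t h ht hh => ?_⟩
  set v : EuclideanSpace ℝ (Fin 2) → ℝ := fun x => Real.smoothTransition ((φ x - t) / h) with hv
  have hvC : ContDiff ℝ 1 v :=
    Real.smoothTransition.contDiff.comp ((hφ.sub contDiff_const).div_const h)
  have hvs : HasCompactSupport v := by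
    refine hs.mono fun x hx hx0 => hx ?_
    rw [hv]
    simp only
    rw [hx0]
    exact Real.smoothTransition.zero_of_nonpos (div_nonpos_of_nonpos_of_nonneg (by linarith) hh.le)
  set A := φ ⁻¹' Set.Ioc t (t + h) with hA
  have hAm : MeasurableSet A := hφ.continuous.measurable measurableSet_Ioc
  have hder : ∀ x, ‖fderiv ℝ v x‖ₑ ≤
      A.indicator (fun x => ENNReal.ofReal (D / h) * ‖fderiv ℝ φ x‖ₑ) x := by
    intro x
    have h1 : HasFDerivAt (fun x => (φ x - t) / h) (h⁻¹ • fderiv ℝ φ x) x := by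
      simp only [div_eq_mul_inv]
      exact (((hφ.differentiable one_ne_zero) x).hasFDerivAt.sub_const t).mul_const h⁻¹
    have h2 := ((Real.smoothTransition.contDiff (n := 1)).differentiable one_ne_zero
      ((φ x - t) / h)).hasDerivAt.comp_hasFDerivAt x h1
    have h3 : fderiv ℝ v x = deriv Real.smoothTransition ((φ x - t) / h) •
      (h⁻¹ • fderiv ℝ φ x) := h2.fderiv
    by_cases hx : x ∈ A
    · rw [Set.indicator_of_mem hx, h3, smul_smul, enorm_smul, Real.enorm_eq_ofReal_abs, abs_mul,
        abs_of_pos (inv_pos.2 hh), div_eq_mul_inv (D : ℝ) h]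
      gcongr
      exact hDle _
    · have h0 : deriv Real.smoothTransition ((φ x - t) / h) = 0 := by
        apply deriv_smoothTransition_eq_zero
        by_contra! hcon
        refine hx ⟨?_, ?_⟩
        · have := (div_pos_iff_of_pos_right hh).1 hcon.1
          linarith
        · have := (div_lt_one hh).1 hcon.2
          linarith
      rw [Set.indicator_of_notMem hx, h3, h0, zero_smul, ← ofReal_norm, norm_zero,
        ENNReal.ofReal_zero]
  have hsob : eLpNorm v 2 volume ≤ K * eLpNorm (fderiv ℝ v) 1 volume := by
    have hp : NNReal.HolderConjugate (Module.finrank ℝ (EuclideanSpace ℝ (Fin 2))) 2 := by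
      rw [finrank_euclideanSpace_fin]
      exact_mod_cast NNReal.HolderConjugate.two_two
    exact_mod_cast eLpNorm_le_eLpNorm_fderiv_one volume hvC hvs hp
  have hlow : volume {x | t + h < φ x} ≤ eLpNorm v 2 volume ^ 2 := by
    rw [eLpNorm_two_sq]
    have hm : MeasurableSet {x | t + h < φ x} :=
      measurableSet_lt measurable_const hφ.continuous.measurable
    calc volume {x | t + h < φ x} = ∫⁻ x in {x | t + h < φ x}, 1 := by simp
      _ ≤ ∫⁻ x in {x | t + h < φ x}, ‖v x‖ₑ ^ 2 := by
        refine setLIntegral_mono' hm fun x hx => ?_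
        have hx' : t + h < φ x := hx
        have : v x = 1 := Real.smoothTransition.one_of_one_le
          ((one_le_div hh).2 (by linarith))
        simp [this]
      _ ≤ _ := setLIntegral_le_lintegral _ _
  have hup : eLpNorm (fderiv ℝ v) 1 volume ^ 2 ≤ ENNReal.ofReal (D / h) ^ 2 *
      (volume {x | t < φ x} * ∫⁻ x in A, ‖fderiv ℝ φ x‖ₑ ^ 2) := by
    rw [eLpNorm_one_eq_lintegral_enorm]
    have h1 : ∫⁻ x, ‖fderiv ℝ v x‖ₑ ≤ ENNReal.ofReal (D / h) * ∫⁻ x in A, ‖fderiv ℝ φ x‖ₑ := by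
      refine (lintegral_mono hder).trans_eq ?_
      rw [lintegral_indicator hAm, lintegral_const_mul' _ _ ENNReal.ofReal_ne_top]
    have h2 := sq_lintegral_le (μ := volume.restrict A) (fun x => ‖fderiv ℝ φ x‖ₑ)
      (hφ.continuous_fderiv one_ne_zero).enorm.measurable.aemeasurable
    rw [Measure.restrict_apply_univ] at h2
    calc (∫⁻ x, ‖fderiv ℝ v x‖ₑ) ^ 2
        ≤ (ENNReal.ofReal (D / h) * ∫⁻ x in A, ‖fderiv ℝ φ x‖ₑ) ^ 2 := by gcongr
      _ = ENNReal.ofReal (D / h) ^ 2 * (∫⁻ x in A, ‖fderiv ℝ φ x‖ₑ) ^ 2 := mul_pow _ _ _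
      _ ≤ _ := by
        gcongr
        refine h2.trans ?_
        gcongr
        exact fun x hx => hx.1
  have hDh : ENNReal.ofReal (h ^ 2) * ENNReal.ofReal (D / h) ^ 2 =
      (D : ℝ≥0∞) ^ 2 := by
    rw [← ENNReal.ofReal_pow (by positivity), ← ENNReal.ofReal_mul (by positivity),
      show h ^ 2 * (D / h) ^ 2 = D ^ 2 by field_simp, ENNReal.ofReal_pow hD.le,
      ENNReal.ofReal_coe_nnreal]
  calc ENNReal.ofReal (h ^ 2) * volume {x | t + h < φ x}
      ≤ ENNReal.ofReal (h ^ 2) * (K ^ 2 * (ENNReal.ofReal (D / h) ^ 2 *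
          (volume {x | t < φ x} * ∫⁻ x in A, ‖fderiv ℝ φ x‖ₑ ^ 2))) := by
        gcongr
        refine hlow.trans ((pow_le_pow_left' hsob 2).trans ?_)
        rw [mul_pow]
        gcongr
    _ = K ^ 2 * (ENNReal.ofReal (h ^ 2) * ENNReal.ofReal (D / h) ^ 2) *
          (∫⁻ x in A, ‖fderiv ℝ φ x‖ₑ ^ 2) * volume {x | t < φ x} := by ring
    _ ≤ _ := by
        rw [hDh]
        gcongr
        push_cast
        exact le_self_add

/-- Iterating the decay over `n` equidistant levels, and estimating the product of the gradient
energies of the layers by `b ≤ exp (b - 1)` (an arithmetic–geometric mean inequality), yields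
geometric decay at levels proportional to `√n`. -/
theorem exists_superlevel_le : ∃ L : ℝ, 0 < L ∧
    ∀ φ : EuclideanSpace ℝ (Fin 2) → ℝ, ContDiff ℝ 1 φ → HasCompactSupport φ →
      ∀ M : ℝ, 0 < M → eLpNorm (fderiv ℝ φ) 2 volume ≤ ENNReal.ofReal M → ∀ n : ℕ,
        4 ^ n * volume.real {x | L * M * √n < φ x} ≤ volume.real {x | 0 < φ x} := by
  obtain ⟨L, hL, hdecay⟩ := exists_superlevel_decay
  -- With this constant the factor of one step is `n a / (4 M²)`, `a` the energy of the layer, and the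
  -- energies of all layers add up to at most `M²`.
  refine ⟨√(4 * L), by positivity, fun φ hφ hs M hM hgrad n => ?_⟩
  rcases Nat.eq_zero_or_pos n with rfl | hn
  · simp
  have hn' : (0 : ℝ) < n := by exact_mod_cast hn
  set h : ℝ := √(4 * L) * M / √n with hh_def
  have hh : 0 < h := by positivity
  have hh2 : h ^ 2 = 4 * L * M ^ 2 / n := by
    rw [hh_def, div_pow, mul_pow, Real.sq_sqrt (by positivity), Real.sq_sqrt hn'.le]
  set g : ℝ → ℝ≥0∞ := fun t => ∫⁻ x in {x | φ x ≤ t}, ‖fderiv ℝ φ x‖ₑ ^ 2 with hg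
  have hgM : ∀ t, g t ≤ ENNReal.ofReal (M ^ 2) := by
    intro t
    refine (setLIntegral_le_lintegral _ _).trans ?_
    rw [← eLpNorm_two_sq, ENNReal.ofReal_pow hM.le]
    gcongr
  have hgfin : ∀ t, g t ≠ ⊤ := fun t => ((hgM t).trans_lt ENNReal.ofReal_lt_top).ne
  set m : ℝ → ℝ := fun t => volume.real {x | t < φ x} with hm
  have hm0 : ∀ t, 0 ≤ m t := fun t => measureReal_nonneg
  have hstep : ∀ t, 0 ≤ t →
      4 * m (t + h) ≤ Real.exp (n / M ^ 2 * ((g (t + h)).toReal - (g t).toReal) - 1) * m t := by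
    intro t ht
    set a := ∫⁻ x in φ ⁻¹' Set.Ioc t (t + h), ‖fderiv ℝ φ x‖ₑ ^ 2
    have hsplit : g (t + h) = g t + a := by
      rw [hg]
      simp only
      rw [← lintegral_union (hφ.continuous.measurable measurableSet_Ioc)]
      · congr 2
        ext x
        simp only [Set.mem_ofPred_eq, Set.mem_union, Set.mem_preimage, Set.mem_Ioc]
        constructor
        · intro hx
          exact (le_or_gt (φ x) t).imp id fun h' => ⟨h', hx⟩
        · rintro (hx | hx)
          · linarith
          · exact hx.2
      · exact Set.disjoint_left.2 fun x hx hx' => not_lt_of_ge hx hx'.1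
    have ha : a ≠ ⊤ := ne_top_of_le_ne_top (hgfin (t + h)) (hsplit ▸ le_add_self)
    have hreal : h ^ 2 * m (t + h) ≤ L * a.toReal * m t := by
      have := ENNReal.toReal_mono (ENNReal.mul_ne_top (ENNReal.mul_ne_top ENNReal.coe_ne_top ha)
        (measure_superlevel_ne_top hs ht)) (hdecay φ hφ hs t h ht hh)
      simpa only [ENNReal.toReal_mul, ENNReal.toReal_ofReal (sq_nonneg h),
        ENNReal.coe_toReal, hm, Measure.real] using this
    have hdiff : (g (t + h)).toReal - (g t).toReal = a.toReal := by
      rw [hsplit, ENNReal.toReal_add (hgfin t) ha]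
      ring
    rw [hdiff]
    have hb := Real.add_one_le_exp (n / M ^ 2 * a.toReal - 1)
    rw [sub_add_cancel] at hb
    refine le_trans ?_ (mul_le_mul_of_nonneg_right hb (hm0 t))
    have hL' : (0 : ℝ) < L := hL
    rw [hh2] at hreal
    have hpos : (0 : ℝ) < L * M ^ 2 / n := by positivity
    refine le_of_mul_le_mul_left ?_ hpos
    calc L * M ^ 2 / n * (4 * m (t + h)) = 4 * L * M ^ 2 / n * m (t + h) := by ring
      _ ≤ L * a.toReal * m t := hreal
      _ = _ := by field_simp
  have hiter : ∀ j : ℕ, 4 ^ j * m (j * h) ≤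
      Real.exp (n / M ^ 2 * (g (j * h)).toReal - j) * m 0 := by
    intro j
    induction j with
    | zero =>
      simp only [Nat.cast_zero, zero_mul, pow_zero, one_mul, sub_zero]
      refine le_mul_of_one_le_left (hm0 0) (Real.one_le_exp (by positivity))
    | succ j ih =>
      have h1 := hstep (j * h) (by positivity)
      have h2 : ((j + 1 : ℕ) : ℝ) * h = j * h + h := by push_cast; ring
      rw [h2]
      set e := Real.exp (n / M ^ 2 * ((g (j * h + h)).toReal - (g (j * h)).toReal) - 1) with he
      calc 4 ^ (j + 1) * m (j * h + h) = 4 ^ j * (4 * m (j * h + h)) := by ring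
        _ ≤ 4 ^ j * (e * m (j * h)) := by gcongr
        _ = e * (4 ^ j * m (j * h)) := by ring
        _ ≤ e * (Real.exp (n / M ^ 2 * (g (j * h)).toReal - j) * m 0) := by
            gcongr
        _ = _ := by
            rw [← mul_assoc, he, ← Real.exp_add]
            congr 2
            push_cast
            ring
  have hfinal := hiter n
  have hnh : (n : ℝ) * h = √(4 * L) * M * √n := by
    rw [hh_def]
    have : √(n : ℝ) ≠ 0 := by positivity
    field_simp
    rw [Real.sq_sqrt hn'.le]
  rw [← hnh]
  refine hfinal.trans (mul_le_of_le_one_left (hm0 0) (Real.exp_le_one_iff.2 ?_))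
  have hle : (g (n * h)).toReal ≤ M ^ 2 := ENNReal.toReal_le_of_le_ofReal (sq_nonneg M) (hgM _)
  calc n / M ^ 2 * (g (n * h)).toReal - n ≤ n / M ^ 2 * M ^ 2 - n := by gcongr
    _ = 0 := by field_simp; ring

/-- A layer-cake bound: for `y > 0` the term with `n + 1 = ⌈y⌉` dominates `2 ^ y`. -/
theorem ofReal_two_rpow_le (y : ℝ) :
    ENNReal.ofReal (2 ^ y) ≤
      1 + ∑' n : ℕ, if (n : ℝ) < y then ENNReal.ofReal (2 ^ (n + 1)) else 0 := by
  rcases le_or_gt y 0 with hy | hy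
  · refine le_add_right ?_
    rw [ENNReal.ofReal_le_one]
    exact Real.rpow_le_one_of_one_le_of_nonpos one_le_two hy
  · have hc : 0 < ⌈y⌉₊ := Nat.ceil_pos.2 hy
    obtain ⟨n, hn⟩ := Nat.exists_eq_succ_of_ne_zero hc.ne'
    have hlt : (n : ℝ) < y := Nat.lt_ceil.1 (by omega)
    have hle : y ≤ (n + 1 : ℕ) := (Nat.le_ceil y).trans (by rw [hn])
    refine le_add_left (le_trans ?_ (ENNReal.le_tsum n))
    rw [if_pos hlt]
    refine ENNReal.ofReal_le_ofReal ?_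
    rw [← Real.rpow_natCast]
    exact Real.rpow_le_rpow_of_exponent_le one_le_two hle

/-- **Trudinger's inequality** (without the sharp constant). -/
theorem exists_trudinger (Ω : BoundedDomain 2) {M : ℝ} (hM : 0 < M) :
    ∃ α : ℝ, 0 < α ∧ ∃ B : ℝ≥0∞, B ≠ ⊤ ∧ ∀ φ, IsTestFunction Ω φ →
      eLpNorm (fderiv ℝ φ) 2 volume ≤ ENNReal.ofReal M →
        ∫⁻ x, ENNReal.ofReal (Real.exp (α * φ x ^ 2)) ∂Ω.μ ≤ B := by
  obtain ⟨L, hL, htail⟩ := exists_superlevel_le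
  set l := L * M
  have hl : 0 < l := by positivity
  set V := volume.real Ω.carrier
  -- The exponent turns `exp (α φ²)` into `2 ^ (φ / l)²`, whose growth `2 ^ n` between the levels `l √n`
  -- is slower than the decay `4 ^ (-n)` of the distribution function.
  refine ⟨Real.log 2 / l ^ 2, by positivity,
    Ω.μ Set.univ + ∑' n : ℕ, ENNReal.ofReal (4 * V * (1 / 2) ^ n), ?_, fun φ hφ hgrad => ?_⟩
  · refine ENNReal.add_ne_top.2 ⟨measure_ne_top _ _, ?_⟩
    have hsum : Summable fun n : ℕ => 4 * V * (1 / 2 : ℝ) ^ n :=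
      summable_geometric_two.mul_left _
    exact hsum.tsum_ofReal_ne_top
  have hone : ∀ ψ, IsTestFunction Ω ψ → eLpNorm (fderiv ℝ ψ) 2 volume ≤ ENNReal.ofReal M →
      ∀ n : ℕ, volume {x | l * √n < ψ x} ≤ ENNReal.ofReal (V / 4 ^ n) := by
    intro ψ hψ hg n
    rw [← ENNReal.ofReal_toReal (measure_superlevel_ne_top hψ.compact (by positivity))]
    refine ENNReal.ofReal_le_ofReal ?_
    rw [le_div_iff₀ (by positivity), mul_comm]
    refine (htail ψ hψ.contDiff_one hψ.compact M hM hg n).trans ?_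
    refine measureReal_mono (fun x hx => ?_) Ω.isBounded.measure_lt_top.ne
    exact hψ.support_subset (ne_of_gt hx : ψ x ≠ 0)
  have hneg : IsTestFunction Ω (-φ) := by simpa using hφ.const_smul (-1)
  have hlev : ∀ n : ℕ, Ω.μ {x | (n : ℝ) < φ x ^ 2 / l ^ 2} ≤ ENNReal.ofReal (2 * V / 4 ^ n) := by
    intro n
    have hsub : {x | (n : ℝ) < φ x ^ 2 / l ^ 2} ⊆ {x | l * √n < φ x} ∪ {x | l * √n < (-φ) x} := by
      intro x hx
      have h1 : (n : ℝ) < (|φ x| / l) ^ 2 := by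
        rw [div_pow, sq_abs]
        exact hx
      have h2 : l * √n < |φ x| := by
        rw [mul_comm, ← lt_div_iff₀ hl]
        exact (Real.sqrt_lt_sqrt n.cast_nonneg h1).trans_eq (Real.sqrt_sq (by positivity))
      exact (lt_abs.1 h2)
    calc Ω.μ {x | (n : ℝ) < φ x ^ 2 / l ^ 2}
        ≤ volume ({x | l * √n < φ x} ∪ {x | l * √n < (-φ) x}) :=
          (Measure.restrict_apply_le _ _).trans (measure_mono hsub)
      _ ≤ ENNReal.ofReal (V / 4 ^ n) + ENNReal.ofReal (V / 4 ^ n) := by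
          refine (measure_union_le _ _).trans (add_le_add (hone φ hφ hgrad n) (hone _ hneg ?_ n))
          refine (eLpNorm_congr_norm_ae (Eventually.of_forall fun x => ?_)).trans_le hgrad
          rw [show fderiv ℝ (-φ) x = -fderiv ℝ φ x from fderiv_neg, norm_neg]
      _ = _ := by
          rw [← ENNReal.ofReal_add (by positivity) (by positivity)]
          congr 1
          ring
  have hmeas : ∀ n : ℕ, MeasurableSet {x | (n : ℝ) < φ x ^ 2 / l ^ 2} := fun n =>
    measurableSet_lt measurable_const ((hφ.continuous.pow 2).div_const _).measurable
  calc ∫⁻ x, ENNReal.ofReal (Real.exp (Real.log 2 / l ^ 2 * φ x ^ 2)) ∂Ω.μ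
      ≤ ∫⁻ x, (1 + ∑' n : ℕ, {x | (n : ℝ) < φ x ^ 2 / l ^ 2}.indicator
          (fun _ => ENNReal.ofReal (2 ^ (n + 1))) x) ∂Ω.μ := by
        refine lintegral_mono fun x => ?_
        rw [show Real.log 2 / l ^ 2 * φ x ^ 2 = Real.log 2 * (φ x ^ 2 / l ^ 2) by ring,
          ← Real.rpow_def_of_pos two_pos]
        exact ofReal_two_rpow_le _
    _ = Ω.μ Set.univ + ∑' n : ℕ, ENNReal.ofReal (2 ^ (n + 1)) *
          Ω.μ {x | (n : ℝ) < φ x ^ 2 / l ^ 2} := by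
        rw [lintegral_add_left measurable_const, lintegral_one,
          lintegral_tsum fun n => (measurable_const.indicator (hmeas n)).aemeasurable]
        congr 2 with n
        exact lintegral_indicator_const (hmeas n) _
    _ ≤ _ := by
        gcongr with n
        refine (mul_le_mul' le_rfl (hlev n)).trans_eq ?_
        rw [← ENNReal.ofReal_mul (by positivity)]
        congr 1
        rw [show (4 : ℝ) ^ n = 2 ^ n * 2 ^ n by rw [← mul_pow]; norm_num, one_div, inv_pow]
        field_simp
        ring

end Trudinger

/-! ### Growth conditions and the energy functional -/

section Growth

variable {N : ℕ} [N.AtLeastTwo] {Ω : BoundedDomain N} {f : ℝ → ℝ}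

/-- By Fatou's lemma it suffices to bound the substitution operator on test functions. -/
theorem boundedSubstitution_of_testFunction (hf : Continuous f)
    (h : ∀ M : ℝ, 0 < M → ∃ r : ℝ≥0∞, 2 < r ∧ ∃ B : ℝ≥0∞, B ≠ ⊤ ∧ ∀ φ, IsTestFunction Ω φ →
      eLpNorm (fderiv ℝ φ) 2 volume ≤ ENNReal.ofReal M → eLpNorm (fun x => f (φ x)) r Ω.μ ≤ B) :
    BoundedSubstitution (H01.valL Ω) f := by
  intro M
  obtain ⟨r, hr, B, hB, hle⟩ := h (|M| + 1) (by positivity)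
  refine ⟨r, hr, B, hB, fun u hu => ?_⟩
  obtain ⟨w, φ, hw, hφ⟩ := H01.exists_seq_testFunction u
  have hval : Tendsto (fun n => H01.val (w n)) atTop (𝓝 (H01.val u)) :=
    ((H01.valL Ω).continuous.tendsto u).comp hw
  obtain ⟨k, hk, hae⟩ := (tendstoInMeasure_of_tendsto_Lp hval).exists_seq_tendsto_ae
  have hlim : ∀ᵐ x ∂Ω.μ, Tendsto (fun n => f (φ (k n) x)) atTop (𝓝 (f (H01.valL Ω u x))) := by
    filter_upwards [hae, ae_all_iff.2 fun n => (hφ n).2.1] with x hx hx'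
    simp only [hx'] at hx
    exact (hf.tendsto _).comp hx
  refine (Lp.eLpNorm_lim_le_liminf_eLpNorm
    (fun n => (hf.comp (hφ (k n)).1.continuous).aestronglyMeasurable) _ hlim).trans ?_
  have hev : ∀ᶠ n in atTop, ‖w (k n)‖ ≤ |M| + 1 := by
    have h1 : Tendsto (fun n => ‖w (k n)‖) atTop (𝓝 ‖u‖) := (hw.comp hk.tendsto_atTop).norm
    exact h1.eventually_le_const (by linarith [le_abs_self M])
  refine liminf_le_of_frequently_le' (Eventually.frequently ?_)
  filter_upwards [hev] with n hn
  refine hle _ (hφ (k n)).1 ?_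
  rw [(hφ (k n)).1.eLpNorm_fderiv (hφ (k n)).2.2]
  exact ENNReal.ofReal_le_ofReal hn

/-- Polynomial growth below half the critical Sobolev exponent. -/
theorem boundedSubstitution_of_rpow (hN : 3 ≤ N) (hf : Continuous f) {q C p : ℝ}
    (hq : q ≤ 2 * (N : ℝ) / ((N : ℝ) - 2)) (hp : 1 < p) (hpq : p < q / 2)
    (hle : ∀ t, |f t| ≤ C * (1 + |t| ^ p)) : BoundedSubstitution (H01.valL Ω) f := by
  have hN' : (3 : ℝ) ≤ N := by exact_mod_cast hN
  have hp0 : 0 < p := by linarith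
  have hq0 : 0 < q := by linarith
  refine boundedSubstitution_of_testFunction hf fun M hM => ?_
  set q' : ℝ≥0 := ⟨q, hq0.le⟩
  -- `|φ| ^ p` lies in `L^(q / p)`, and `q / p > 2` because `p` is below half the Sobolev exponent `q`.
  set r : ℝ≥0∞ := ENNReal.ofReal (q / p) with hr_def
  have hr : 2 < r := by
    rw [hr_def, ← ENNReal.ofReal_ofNat, ENNReal.ofReal_lt_ofReal_iff (by positivity),
      lt_div_iff₀ hp0]
    linarith
  set K := eLpNormLESNormFDerivOfLeConst ℝ (volume : Measure (EuclideanSpace ℝ (Fin N)))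
    Ω.carrier 2 q'
  set A := eLpNorm (fun _ : EuclideanSpace ℝ (Fin N) => (1 : ℝ)) r Ω.μ
  have hA : A ≠ ⊤ := (memLp_const (1 : ℝ)).eLpNorm_ne_top
  refine ⟨r, hr, ‖C‖ₑ * (A + (K * ENNReal.ofReal M) ^ p), ?_, fun φ hφ hgrad => ?_⟩
  · refine ENNReal.mul_ne_top (by simp) (ENNReal.add_ne_top.2 ⟨hA, ?_⟩)
    exact ENNReal.rpow_ne_top_of_nonneg hp0.le
      (ENNReal.mul_ne_top ENNReal.coe_ne_top ENNReal.ofReal_ne_top)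
  have hsob : eLpNorm φ (ENNReal.ofReal q) Ω.μ ≤ K * ENNReal.ofReal M := by
    have hinv : ((2 : ℝ≥0) : ℝ)⁻¹ - (Module.finrank ℝ (EuclideanSpace ℝ (Fin N)) : ℝ)⁻¹ ≤
        (q' : ℝ)⁻¹ := by
      rw [finrank_euclideanSpace_fin]
      change (2 : ℝ)⁻¹ - (N : ℝ)⁻¹ ≤ q⁻¹
      have h1 : (2 * (N : ℝ) / ((N : ℝ) - 2))⁻¹ ≤ q⁻¹ := inv_anti₀ hq0 hq
      refine le_of_eq_of_le ?_ h1
      rw [inv_div]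
      field_simp
    have h2 := eLpNorm_le_eLpNorm_fderiv_of_le (p := 2) (q := q') volume hφ.contDiff_one
      hφ.support_subset one_le_two
      (by rw [finrank_euclideanSpace_fin]; exact_mod_cast (by omega : 2 < N)) hinv Ω.isBounded
    rw [ENNReal.ofReal_eq_coe_nnreal hq0.le]
    refine (eLpNorm_mono_measure _ Measure.restrict_le_self).trans (h2.trans ?_)
    gcongr
    exact_mod_cast hgrad
  have hc := hφ.continuous
  have hcp : Continuous fun x => ‖φ x‖ ^ p := hc.norm.rpow_const fun x => Or.inr hp0.le
  have hpow : eLpNorm (fun x => ‖φ x‖ ^ p) r Ω.μ = eLpNorm φ (ENNReal.ofReal q) Ω.μ ^ p := by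
    rw [eLpNorm_norm_rpow φ hp0, hr_def, ← ENNReal.ofReal_mul (by positivity),
      div_mul_cancel₀ _ hp0.ne']
  calc eLpNorm (fun x => f (φ x)) r Ω.μ
      ≤ eLpNorm (C • ((fun _ => (1 : ℝ)) + fun x => ‖φ x‖ ^ p)) r Ω.μ :=
        eLpNorm_mono_real fun x => hle (φ x)
    _ ≤ ‖C‖ₑ * eLpNorm ((fun _ => (1 : ℝ)) + fun x => ‖φ x‖ ^ p) r Ω.μ :=
        eLpNorm_const_smul_le
    _ ≤ ‖C‖ₑ * (A + eLpNorm (fun x => ‖φ x‖ ^ p) r Ω.μ) := by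
        gcongr
        exact eLpNorm_add_le aestronglyMeasurable_const hcp.aestronglyMeasurable
          (one_le_two.trans hr.le)
    _ ≤ _ := by
        rw [hpow]
        gcongr

/-- Integration of the growth condition on the derivative. -/
theorem exists_abs_le_exp_sq (hf : ContDiff ℝ 1 f) {β : ℝ} (hβ : 0 < β)
    (h : Tendsto (fun t : ℝ => deriv f t / Real.exp (β * t ^ 2)) (cocompact ℝ) (𝓝 0)) :
    ∃ C, 0 ≤ C ∧ ∀ t, |f t| ≤ C * Real.exp (2 * β * t ^ 2) := by
  have hcd : Continuous (deriv f) := hf.continuous_deriv le_rfl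
  have hcont : Continuous fun t : ℝ => deriv f t / Real.exp (β * t ^ 2) :=
    hcd.div (by fun_prop) fun t => (Real.exp_pos _).ne'
  obtain ⟨K, hK⟩ := (ZeroAtInftyContinuousMap.isBounded_range
    (⟨⟨_, hcont⟩, h⟩ : ZeroAtInftyContinuousMap ℝ ℝ)).exists_norm_le
  have hK' : ∀ t, ‖deriv f t‖ ≤ K * Real.exp (β * t ^ 2) := by
    intro t
    have h1 : ‖deriv f t / Real.exp (β * t ^ 2)‖ ≤ K := hK _ ⟨t, rfl⟩
    rwa [norm_div, Real.norm_of_nonneg (Real.exp_pos _).le, div_le_iff₀ (Real.exp_pos _)] at h1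
  have hK0 : 0 ≤ K := (norm_nonneg _).trans (hK _ ⟨0, rfl⟩)
  refine ⟨|f 0| + K * (1 + 1 / β), by positivity, fun t => ?_⟩
  set e := Real.exp (β * t ^ 2) with he
  have hmvt : ‖f t - f 0‖ ≤ K * e * ‖t - 0‖ := by
    refine Convex.norm_image_sub_le_of_norm_deriv_le (s := Metric.closedBall (0 : ℝ) |t|)
      (fun s _ => (hf.differentiable one_ne_zero) s) (fun s hs => ?_)
      (convex_closedBall _ _) (by simp) (by simp)
    refine (hK' s).trans ?_
    rw [mem_closedBall_zero_iff, Real.norm_eq_abs] at hs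
    have := sq_le_sq.2 hs
    gcongr
    exact Real.exp_le_exp.2 (by gcongr)
  have he1 : 1 + β * t ^ 2 ≤ e := by linarith [Real.add_one_le_exp (β * t ^ 2)]
  have he2 : |t| ≤ (1 + 1 / β) * e := by
    have h1 : |t| ≤ 1 + t ^ 2 := by nlinarith [sq_abs t, sq_nonneg (|t| - 1), abs_nonneg t]
    have h2 : 1 + t ^ 2 ≤ (1 + 1 / β) * (1 + β * t ^ 2) := by
      have : (1 + 1 / β) * (1 + β * t ^ 2) = 1 + t ^ 2 + 1 / β + β * t ^ 2 := by
        field_simp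
        ring
      rw [this]
      have h3 : 0 ≤ 1 / β + β * t ^ 2 := by positivity
      linarith
    exact h1.trans (h2.trans (by gcongr))
  have he3 : Real.exp (2 * β * t ^ 2) = e * e := by
    rw [he, ← Real.exp_add]
    ring_nf
  have he4 : 1 ≤ e := le_trans (by nlinarith [sq_nonneg t]) he1
  rw [sub_zero, Real.norm_eq_abs, Real.norm_eq_abs] at hmvt
  calc |f t| = |f 0 + (f t - f 0)| := by ring_nf
    _ ≤ |f 0| + |f t - f 0| := abs_add_le _ _
    _ ≤ |f 0| * (e * e) + K * e * ((1 + 1 / β) * e) := by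
        refine add_le_add (le_mul_of_one_le_right (abs_nonneg _)
          (one_le_mul_of_one_le_of_one_le he4 he4))
          (hmvt.trans (by gcongr))
    _ = _ := by rw [he3]; ring

/-- Growth below every Gaussian exponential in the plane. -/
theorem boundedSubstitution_of_exp {Ω : BoundedDomain 2} (hf : ContDiff ℝ 1 f)
    (h : ∀ β : ℝ, 0 < β →
      Tendsto (fun t : ℝ => deriv f t / Real.exp (β * t ^ 2)) (cocompact ℝ) (𝓝 0)) :
    BoundedSubstitution (H01.valL Ω) f := by
  refine boundedSubstitution_of_testFunction hf.continuous fun M hM => ?_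
  obtain ⟨α, hα, B, hB, htr⟩ := exists_trudinger Ω hM
  obtain ⟨C, hC, hle⟩ := exists_abs_le_exp_sq hf (β := α / 8) (by positivity) (h _ (by positivity))
  -- The fourth power of `exp (2 (α / 8) t²)` is `exp (α t²)`.
  refine ⟨4, by norm_num, (ENNReal.ofReal (C ^ 4) * B) ^ (4 : ℝ)⁻¹, ?_, fun φ hφ hgrad => ?_⟩
  · exact ENNReal.rpow_ne_top_of_nonneg (by positivity)
      (ENNReal.mul_ne_top ENNReal.ofReal_ne_top hB)
  rw [ENNReal.le_rpow_inv_iff (by norm_num)]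
  have h4 := eLpNorm_nnreal_pow_eq_lintegral (μ := Ω.μ) (f := fun x => f (φ x)) (p := 4) (by simp)
  push_cast at h4
  rw [h4]
  calc ∫⁻ x, ‖f (φ x)‖ₑ ^ (4 : ℝ) ∂Ω.μ
      ≤ ∫⁻ x, ENNReal.ofReal (C ^ 4) * ENNReal.ofReal (Real.exp (α * φ x ^ 2)) ∂Ω.μ := by
        refine lintegral_mono fun x => ?_
        rw [← ofReal_norm, ENNReal.ofReal_rpow_of_nonneg (norm_nonneg _) (by norm_num),
          ← ENNReal.ofReal_mul (by positivity)]
        refine ENNReal.ofReal_le_ofReal ?_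
        rw [show (4 : ℝ) = (4 : ℕ) by norm_num, Real.rpow_natCast]
        refine (pow_le_pow_left₀ (norm_nonneg _) (hle (φ x)) 4).trans_eq ?_
        rw [mul_pow, ← Real.exp_nat_mul]
        congr 2
        push_cast
        ring
    _ ≤ _ := by
        rw [lintegral_const_mul' _ _ ENNReal.ofReal_ne_top]
        gcongr
        exact htr φ hφ hgrad

theorem SubcriticalGrowth.boundedSubstitution (hf : ContDiff ℝ 1 f) (h : SubcriticalGrowth N f) :
    BoundedSubstitution (H01.valL Ω) f := by
  rcases (Nat.AtLeastTwo.prop : 2 ≤ N).eq_or_lt with rfl | hN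
  · exact boundedSubstitution_of_exp hf (h.1 rfl)
  · obtain ⟨q, -, hq, C, p, -, hp, hpq, hle⟩ := h.2 hN
    exact boundedSubstitution_of_rpow hN hf.continuous hq hp hpq hle

/-- The energy is the abstract one for the embedding of `H^1_0(Ω)` into `L²(Ω)`. -/
theorem energy_eq_abstractEnergy (Ω : BoundedDomain N) (f : ℝ → ℝ) :
    energy Ω f = abstractEnergy (H01.valL Ω) f := by
  funext u
  have h : ‖u‖ ^ 2 = ∫ x, ‖H01.grad u x‖ ^ 2 ∂Ω.μ := by
    rw [H01.norm_eq, ← real_inner_self_eq_norm_sq, L2.inner_def]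
    simp_rw [real_inner_self_eq_norm_sq]
  rw [energy, abstractEnergy, h, integral_const_mul]
  rfl

end Growth

end SemilinearPS

theorem mainTheorem8 (N : ℕ) [N.AtLeastTwo] (Ω : SemilinearPS.BoundedDomain N)
    (f : ℝ → ℝ) (hf : ContDiff ℝ 1 f)
    (hf1 : SemilinearPS.SubcriticalGrowth N f) (hf2 : SemilinearPS.SuperlinearAtZero f)
    (hf3 : SemilinearPS.AmbrosettiRabinowitz f) :
    (∀ u : SemilinearPS.H01 Ω,
      Integrable (fun x => SemilinearPS.primitive f (SemilinearPS.H01.val u x)) Ω.μ) ∧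
    ContDiff ℝ 1 (SemilinearPS.energy Ω f) ∧
    SemilinearPS.PalaisSmale (SemilinearPS.energy Ω f) := by
  have hb := hf1.boundedSubstitution (Ω := Ω) hf
  rw [SemilinearPS.energy_eq_abstractEnergy]
  exact ⟨hb.integrable_primitive hf.continuous,
    SemilinearPS.contDiff_abstractEnergy hb hf.continuous,
    SemilinearPS.palaisSmale_abstractEnergy hb hf.continuous
      (SemilinearPS.sequentiallyCompactMap_valL Ω) hf3⟩
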